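/- **Theorem (exponential decay of $g_p$).** Let $d\ge 2$ and consider hyperbolic space $\mathbb H^d$ in the half-space model $\mathbb R^{d-1}\times(0,\infty)$, with $o=(0,\dots,0,1)$; let $\partial\mathbb H^d=(\mathbb R^{d-1}\times\{0\})\cup\{\infty\}$ be its boundary at infinity, and for $C\subseteq\mathbb H^d$ let $\partial C$ be the set of points of $\partial\mathbb H^d$ in the closure of $C$ in $\mathbb H^d\cup\partial\mathbb H^d$. Let $G$ be a connected simple graph embedded in $\mathbb H^d$, having $o$ as a vertex, such that - its edges are hyperbolic geodesic segments; - it is locally finite: every compact subset of $\mathbb H^d$ meets only finitely many vertices and edges; - it is transitive under isometries: some group of isometries of $\mathbb H^d$ acts on $G$ by graph automorphisms, transitively on the vertices. For $p\in[0,1]$ let $\mathbb P_p$ be the law of $p$-Bernoulli bond percolation $\omega$ on $G$ (each edge is open independently with probability $p$), let $C(o)$ be the cluster of $o$, and put $$\mathcal N=\{p\in[0,1]:\ \mathbb P_p(x\in\partial C(o))=0\ \text{ for all } x\in\partial\mathbb H^d\},\qquad p_0=\sup\mathcal N .$$ For $h\in(0,1]$ and $R\in O(d)$ let $\Phi^{(h,R)}$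 be the unique isometry of $\mathbb H^d$ with $\Phi^{(h,R)}(o)=(0,\dots,0,h)$ whose ordinary derivative at $o$ is $hR$. Let $L=\mathbb R^{d-1}\times(0,1]$, and let $\Phi^{(h,R)}[G]\cap L$ be the graph whose vertices are the vertices of $\Phi^{(h,R)}[G]$ in $L$ and the points where edges of $\Phi^{(h,R)}[G]$ meet the boundary of $L$, and whose edges are the non-degenerate connected components of the sets $\Phi^{(h,R)}[e]\cap L$, $e$ an edge of $G$; such a component is open if and only if $e$ is open in $\omega$. For $r>0$ let $S_r$ be the boundary in $\mathbb H^d$ of $\{y\in\mathbb H^d:\max_{1\le i\le d-1}|y_i|\le r\}$, and let $$g_p(r)=\sup_{(h,R)\in(0,1]\times O(d)}\mathbb P_p\bigl(\text{some open path in }\Phi^{(h,R)}[G]\cap L\text{ starts at }\Phi^{(h,R)}(o)\text{ and intersects } S_r\bigr).$$ Then for every $p\in[0,1]$ with $p<p_0$ there exists $\psi=\psi(p)>0$ such that $$g_p(r)\le e^{-\psi r}\qquad\text{for all } r>0 .$$ -/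

import Mathlib

namespace HypPerc

noncomputable section

open MeasureTheory ProbabilityTheory

/-! ### The half-space model of hyperbolic space of dimension `d = n + 1` -/

/-- The Euclidean space `ℝ^d` with `d = n + 1`. -/
abbrev E (n : ℕ) : Type := EuclideanSpace ℝ (Fin (n + 1))

/-- Hyperbolic space `ℍ^d`, `d = n + 1`, in the Poincaré half-space model: the points of `ℝ^d` whose
last coordinate is positive. Its topology is the subspace topology (which is also the topology of
the hyperbolic metric `hdist` below). -/
abbrev HalfSpace (n : ℕ) : Type := {x : E n // 0 < x (Fin.last n)}

/-- The height of a point: its last coordinate. -/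
def height {n : ℕ} (x : HalfSpace n) : ℝ := x.1 (Fin.last n)

/-- The hyperbolic distance, `sinh (dist x y / 2) = |x - y| / (2 √(x_d y_d))`. -/
def hdist {n : ℕ} (x y : HalfSpace n) : ℝ :=
  2 * Real.arsinh (‖x.1 - y.1‖ / (2 * √(height x * height y)))

/-- The hyperbolic geodesic segment with endpoints `x` and `y`. -/
def hseg {n : ℕ} (x y : HalfSpace n) : Set (HalfSpace n) :=
  {z | hdist x z + hdist z y = hdist x y}

/-- `Φ` is an isometry of hyperbolic space onto itself. -/
def IsHIsometry {n : ℕ} (Φ : Equiv.Perm (HalfSpace n)) : Prop :=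
  ∀ x y, hdist (Φ x) (Φ y) = hdist x y

/-- The point `(0, …, 0, h)`. -/
def axisPoint (n : ℕ) (h : ℝ) (hh : 0 < h) : HalfSpace n :=
  ⟨EuclideanSpace.single (Fin.last n) h, by simpa using hh⟩

/-- The origin `o = (0, …, 0, 1)`. -/
def origin (n : ℕ) : HalfSpace n := axisPoint n 1 one_pos

/-- A self-map of the open half-space as a map `ℝ^d → ℝ^d`
(with value `0` off the half-space, which does not influence derivatives at its points). -/
def toAmbient {n : ℕ} (Φ : HalfSpace n → HalfSpace n) (x : E n) : E n :=
  open Classical in if hx : 0 < x (Fin.last n) then (Φ ⟨x, hx⟩).1 else 0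

/-- `Φ` is the isometry `Φ^(h,R)` for `h > 0` and `R ∈ O(d)`: the unique isometry of `ℍ^d` with
`Φ(o) = (0, …, 0, h)` whose ordinary derivative at `o` is `h R`. -/
structure IsPhi {n : ℕ} (h : ℝ) (R : E n ≃ₗᵢ[ℝ] E n) (Φ : Equiv.Perm (HalfSpace n)) : Prop where
  isometry : IsHIsometry Φ
  map_origin : (Φ (origin n)).1 = EuclideanSpace.single (Fin.last n) h
  deriv_origin :
    HasFDerivAt (toAmbient Φ) (h • (R.toContinuousLinearEquiv : E n →L[ℝ] E n)) (origin n).1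

/-- The region `L^h = ℝ^(d-1) × (0, h]`. -/
def lowerRegion (n : ℕ) (h : ℝ) : Set (HalfSpace n) := {x | height x ≤ h}

/-- The Euclidean orthogonal projection `ℍ^d → ℝ^(d-1)`. The type `Fin n → ℝ` carries the maximum
norm. -/
def proj {n : ℕ} (x : HalfSpace n) : Fin n → ℝ := fun i => x.1 i.castSucc

/-- The projection distance, measured in the maximum norm. -/
def projDist {n : ℕ} (x y : HalfSpace n) : ℝ := ‖proj x - proj y‖

/-- The set `B_r` of all points at projection distance at most `r` from `o`. -/
def ballB (n : ℕ) (r : ℝ) : Set (HalfSpace n) := {y | projDist (origin n) y ≤ r}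

/-- The topological boundary `S_r` of `B_r` in `ℍ^d`. -/
def sphereS (n : ℕ) (r : ℝ) : Set (HalfSpace n) := frontier (ballB n r)

/-! ### Points at infinity -/

/-- The inclusion of the half-space into `ℝ^d ∪ {∞}`. The closure of its range is the
compactification of `ℍ^d` by its points at infinity. -/
def toCompact {n : ℕ} (x : HalfSpace n) : OnePoint (E n) := (x.1 : OnePoint (E n))

/-- The boundary at infinity `∂C` of a set `C ⊆ ℍ^d`. -/
def bdryAtInfty {n : ℕ} (C : Set (HalfSpace n)) : Set (OnePoint (E n)) :=
  closure (toCompact '' C) \ Set.range toCompact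

/-! ### Graphs embedded in hyperbolic space with geodesic edges -/

variable {n : ℕ} {V : Set (HalfSpace n)}

/-- The geodesic segment that represents the (possible) edge `e`. -/
def edgeSeg (e : Sym2 V) : Set (HalfSpace n) :=
  {z | ∃ u v : V, e = s(u, v) ∧ z ∈ hseg (u : HalfSpace n) v}

/-- `Γ` is transitive under isometries: some group of isometries of `ℍ^d` acts on it by graph
automorphisms, transitively on vertices. -/
def TransitiveUnderIsometries (G : SimpleGraph V) : Prop :=
  ∃ Γ : Subgroup (Equiv.Perm (HalfSpace n)),
    (∀ γ ∈ Γ, IsHIsometry γ ∧ ∃ φ : G ≃g G, ∀ v : V, ((φ v : V) : HalfSpace n) = γ v) ∧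
    ∀ u v : V, ∃ γ ∈ Γ, γ u = v

/-- The simple graph `G` with vertex set `V ⊆ ℍ^d`, each edge being drawn as the geodesic segment
between its endpoints, is an embedded graph which is connected, locally finite and transitive under
isometries. -/
structure IsGeodesicTransitiveGraph (G : SimpleGraph V) : Prop where
  /-- an edge passes through no vertices other than its endpoints -/
  vertex_on_edge : ∀ u v w : V, G.Adj u v → (w : HalfSpace n) ∈ hseg (u : HalfSpace n) v →
    w = u ∨ w = v
  /-- different edges meet at most in a common endpoint -/
  edge_inter : ∀ e ∈ G.edgeSet, ∀ e' ∈ G.edgeSet, e ≠ e' → ∀ z ∈ edgeSeg e ∩ edgeSeg e',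
    ∃ w : V, (w : HalfSpace n) = z ∧ w ∈ e ∧ w ∈ e'
  connected : G.Connected
  finite_vertices : ∀ K : Set (HalfSpace n), IsCompact K → (V ∩ K).Finite
  finite_edges : ∀ K : Set (HalfSpace n), IsCompact K →
    {e ∈ G.edgeSet | (edgeSeg e ∩ K).Nonempty}.Finite
  transitive : TransitiveUnderIsometries G

/-! ### Bernoulli bond percolation -/

/-- The law of `p`-Bernoulli bond percolation on `G`: the product measure on `2^E(G)` under which
each edge is open with probability `p`. -/
def percLaw (G : SimpleGraph V) (p : unitInterval) : Measure (Set G.edgeSet) :=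
  setBernoulli Set.univ p

/-- The subgraph of open edges of a configuration. -/
def openGraph {G : SimpleGraph V} (ω : Set G.edgeSet) : SimpleGraph V :=
  SimpleGraph.fromEdgeSet (Subtype.val '' ω)

/-- The percolation cluster `C(v)` as a subset of `ℍ^d`: the vertices joined to `v` by open paths,
together with the open edges at these vertices. -/
def cluster {G : SimpleGraph V} (ω : Set G.edgeSet) (v : V) : Set (HalfSpace n) :=
  {z | ∃ u : V, (openGraph ω).Reachable v u ∧
    (z = u ∨ ∃ w : V, (openGraph ω).Adj u w ∧ z ∈ hseg (u : HalfSpace n) w)}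

/-- The set `𝒩(G)` of all `p ∈ [0, 1]` such that each point at infinity almost surely does not lie
in the boundary of the cluster of `o`. -/
def nullSet (G : SimpleGraph V) (ho : origin n ∈ V) : Set unitInterval :=
  {p | ∀ x ∈ bdryAtInfty (Set.univ : Set (HalfSpace n)),
    percLaw G p {ω | x ∈ bdryAtInfty (cluster ω ⟨origin n, ho⟩)} = 0}

/-- The threshold `p₀(G) = sup 𝒩(G)`. -/
def pZero (G : SimpleGraph V) (ho : origin n ∈ V) : ℝ :=
  sSup ((fun p : unitInterval => (p : ℝ)) '' nullSet G ho)

/-- The percolation process `Φ[ω] ∩ A` on the embedded graph `Φ[G] ∩ A`, as a graph on points of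
`ℍ^d`: its edges are the non-degenerate connected components of the sets `Φ[e] ∩ A`, where `e` is an
open edge. Each of them is a geodesic segment and joins its two endpoints. -/
def clippedGraph {G : SimpleGraph V} (ω : Set G.edgeSet) (Φ : Equiv.Perm (HalfSpace n))
    (A : Set (HalfSpace n)) : SimpleGraph (HalfSpace n) :=
  SimpleGraph.fromRel fun x y =>
    ∃ e ∈ ω, hseg x y = connectedComponentIn (Φ '' edgeSeg (e : Sym2 V) ∩ A) x

/-- Some path of the graph `H` on points of `ℍ^d` (with geodesic edges) starts at `x` and
intersects `S`, in a vertex or in another point of an edge. -/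
def JoinsTo (H : SimpleGraph (HalfSpace n)) (x : HalfSpace n) (S : Set (HalfSpace n)) : Prop :=
  ∃ y, H.Reachable x y ∧ (y ∈ S ∨ ∃ z, H.Adj y z ∧ (hseg y z ∩ S).Nonempty)

/-- `g_p(r)`: the supremum over `h ∈ (0, 1]` and `R ∈ O(d)` of the probability that `Φ^(h,R)(o)` is
joined to `S_r` by an open path in `Φ^(h,R)[G] ∩ L`, where `L = ℝ^(d-1) × (0, 1]`. -/
def gFun (G : SimpleGraph V) (p : unitInterval) (r : ℝ) : ENNReal :=
  ⨆ (h : ℝ) (R : E n ≃ₗᵢ[ℝ] E n) (Φ : Equiv.Perm (HalfSpace n))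
    (_ : h ∈ Set.Ioc (0 : ℝ) 1 ∧ IsPhi h R Φ),
    percLaw G p {ω | JoinsTo (clippedGraph ω Φ (lowerRegion n 1)) (Φ (origin n)) (sphereS n r)}

end

end HypPerc

/-! Choose `q` in the null set with `p < q`. The argument combines compactness at infinity, used at
`q`, with the Duminil-Copin–Tassion method, which passes from `q` down to `p`.

Compactness (`exists_uniform_small`): at `q`, the probability of reaching projection distance `k +
1` below height `1` is small for some `k`, uniformly over all isometric positions of the graph.
Otherwise bad positions exist for every `k`. Transitivity moves their starting vertices to `o`, and
the target sets then shrink along a subsequence to a single point `ξ` at infinity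
(`exists_limit_of_farSet`). Infinitely many of the bad events occur together with positive
probability, and then `ξ` lies in the boundary of the cluster of `o`, against the choice of `q`.

Sharpness: `bdrySum` is, without the factor `p`, the Duminil-Copin–Tassion functional of a finite
set `S` around `v`. If at `p` it were at least `1/2` for all `S` that avoid the target, Russo's
formula would give `f' ≥ (1 - f) / 2` on `[p, q]` for the connection probability `f`, making `f q`
too large (`prob_joinedIn_ge`). So every low vertex has a set `S` of bounded projection radius with
sum at most `1/2`. Each exit from such a set costs a factor `1/2` (`prob_joinedIn_le_pow`), whence
exponential decay.

Finally, paths of the clipped graph are compared with paths of low vertices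
(`exists_joinedIn_of_joinsTo`). Small `r` is covered by the event that all edges at `o` are closed.
-/

namespace HypPerc

open MeasureTheory ProbabilityTheory

/-! ### Bernoulli percolation on finitely many edges: independence and Russo's formula. -/

section Bernoulli

variable {ι : Type*}

open Classical in
/-- The expectation of `g` under Bernoulli percolation with parameter `p` on the finite set `F`,
all elements off `F` being closed. -/
noncomputable def expect (p : ℝ) (F : Finset ι) (g : Set ι → ℝ) : ℝ :=
  ∑ D ∈ F.powerset, (∏ i ∈ F, if i ∈ D then p else 1 - p) * g D

lemma expect_empty (p : ℝ) (g : Set ι → ℝ) : expect p ∅ g = g ∅ := by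
  simp [expect]

open Classical in
-- Conditioning on the state of `e`; this recursion drives the inductions on `F` below.
lemma expect_insert (p : ℝ) {F : Finset ι} {e : ι} (he : e ∉ F) (g : Set ι → ℝ) :
    expect p (insert e F) g =
      (1 - p) * expect p F g + p * expect p F (fun ω => g (insert e ω)) := by
  unfold expect
  rw [Finset.sum_powerset_insert he, Finset.mul_sum, Finset.mul_sum]
  congr 1
  · refine Finset.sum_congr rfl fun D hD => ?_
    have heD : e ∉ D := fun h => he (Finset.mem_powerset.1 hD h)
    rw [Finset.prod_insert he, if_neg heD, mul_assoc]
  · refine Finset.sum_congr rfl fun D hD => ?_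
    rw [Finset.prod_insert he, if_pos (Finset.mem_insert_self _ _), Finset.coe_insert, mul_assoc]
    congr 2
    refine Finset.prod_congr rfl fun i hi => ?_
    have : i ≠ e := fun h => he (h ▸ hi)
    simp [this]

lemma expect_mono {p : ℝ} (h0 : 0 ≤ p) (h1 : p ≤ 1) (F : Finset ι) {g k : Set ι → ℝ}
    (h : ∀ ω, g ω ≤ k ω) : expect p F g ≤ expect p F k := by
  classical
  unfold expect
  refine Finset.sum_le_sum fun D _ => mul_le_mul_of_nonneg_left (h _) ?_
  refine Finset.prod_nonneg fun i _ => ?_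
  split_ifs <;> linarith

lemma expect_sub (p : ℝ) (F : Finset ι) (g k : Set ι → ℝ) :
    expect p F (fun ω => g ω - k ω) = expect p F g - expect p F k := by
  simp [expect, mul_sub, Finset.sum_sub_distrib]

lemma expect_sum {α : Type*} (p : ℝ) (F : Finset ι) (s : Finset α) (g : α → Set ι → ℝ) :
    expect p F (fun ω => ∑ a ∈ s, g a ω) = ∑ a ∈ s, expect p F (g a) := by
  simp only [expect, Finset.mul_sum]
  rw [Finset.sum_comm]

lemma expect_const (p : ℝ) (F : Finset ι) (c : ℝ) : expect p F (fun _ => c) = c := by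
  classical
  induction F using Finset.induction_on with
  | empty => simp [expect_empty]
  | insert e F he ih => rw [expect_insert p he, ih]; ring

lemma expect_nonneg {p : ℝ} (h0 : 0 ≤ p) (h1 : p ≤ 1) (F : Finset ι) {g : Set ι → ℝ}
    (h : ∀ ω, 0 ≤ g ω) : 0 ≤ expect p F g := by
  simpa [expect_const] using expect_mono h0 h1 F h

open Classical in
lemma expect_insert_of_insensitive (p : ℝ) {F : Finset ι} {e : ι} {g : Set ι → ℝ}
    (hg : ∀ ω, g (insert e ω) = g ω) : expect p (insert e F) g = expect p F g := by
  classical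
  by_cases he : e ∈ F
  · simp [he]
  · rw [expect_insert p he]
    simp only [hg]
    ring

/-- Functions of disjoint sets of coordinates are independent. -/
lemma expect_mul (p : ℝ) (F : Finset ι) (g k : Set ι → ℝ)
    (h : ∀ e ∈ F, (∀ ω, g (insert e ω) = g ω) ∨ (∀ ω, k (insert e ω) = k ω)) :
    expect p F (fun ω => g ω * k ω) = expect p F g * expect p F k := by
  classical
  induction F using Finset.induction_on generalizing g k with
  | empty => simp [expect_empty]
  | insert e F he ih =>
    have hF : ∀ i ∈ F, (∀ ω, g (insert i ω) = g ω) ∨ (∀ ω, k (insert i ω) = k ω) :=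
      fun i hi => h i (Finset.mem_insert_of_mem hi)
    rw [expect_insert p he, ih g k hF]
    rcases h e (Finset.mem_insert_self e F) with hg | hk
    · rw [expect_insert_of_insensitive p hg, expect_insert p he k]
      simp only [hg]
      -- Opening `e` beforehand does not destroy insensitivity to the other coordinates, so the
      -- induction hypothesis covers this function too.
      rw [ih g (fun ω => k (insert e ω))]
      · ring
      · intro i hi
        rcases hF i hi with h' | h'
        · exact Or.inl h'
        · exact Or.inr fun ω => by rw [Set.insert_comm, h']
    · rw [expect_insert_of_insensitive p hk, expect_insert p he g]
      simp only [hk]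
      rw [ih (fun ω => g (insert e ω)) k]
      · ring
      · intro i hi
        rcases hF i hi with h' | h'
        · exact Or.inl fun ω => by rw [Set.insert_comm, h']
        · exact Or.inr h'

/-- Russo's formula. -/
lemma hasDerivAt_expect (F : Finset ι) (g : Set ι → ℝ) (p : ℝ) :
    HasDerivAt (fun q => expect q F g)
      (∑ e ∈ F, expect p F (fun ω => g (insert e ω) - g (ω \ {e}))) p := by
  classical
  induction F using Finset.induction_on generalizing g with
  | empty => simpa [expect_empty] using hasDerivAt_const p (g ∅)
  | insert e F he ih =>
    have hfun : (fun q => expect q (insert e F) g) =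
        fun q => (1 - q) * expect q F g + q * expect q F (fun ω => g (insert e ω)) :=
      funext fun q => expect_insert q he g
    rw [hfun]
    have h1 := (((hasDerivAt_id p).const_sub 1).mul (ih g)).add
      ((hasDerivAt_id p).mul (ih (fun ω => g (insert e ω))))
    refine h1.congr_deriv ?_
    rw [Finset.sum_insert he]
    -- The term of `e` itself: the configurations summed over `F` do not contain `e`, so closing `e`
    -- changes nothing.
    have h2 : expect p (insert e F) (fun ω => g (insert e ω) - g (ω \ {e})) =
        expect p F (fun ω => g (insert e ω)) - expect p F g := by
      rw [expect_insert_of_insensitive, expect_sub]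
      · congr 1
        unfold expect
        refine Finset.sum_congr rfl fun D hD => ?_
        have heD : e ∉ D := fun h => he (Finset.mem_powerset.1 hD h)
        simp only [Set.sdiff_singleton_eq_self (fun h => heD (Finset.mem_coe.1 h))]
      · intro ω
        rw [Set.insert_idem, Set.insert_sdiff_of_mem _ (Set.mem_singleton e)]
    have h3 : ∀ i ∈ F, expect p (insert e F) (fun ω => g (insert i ω) - g (ω \ {i})) =
        (1 - p) * expect p F (fun ω => g (insert i ω) - g (ω \ {i})) +
        p * expect p F (fun ω => g (insert e (insert i ω)) - g (insert e (ω \ {i}))) := by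
      intro i hi
      have hie : e ∉ ({i} : Set ι) := fun h => he (by rw [Set.mem_singleton_iff.1 h]; exact hi)
      rw [expect_insert p he]
      simp only [Set.insert_comm i e, Set.insert_sdiff_of_notMem _ hie]
    rw [h2, Finset.sum_congr rfl h3, Finset.sum_add_distrib, ← Finset.mul_sum, ← Finset.mul_sum]
    simp only [id]
    ring

lemma expect_map {κ : Type*} (σ : ι ≃ κ) (p : ℝ) (F : Finset ι) (g : Set κ → ℝ) :
    expect p (F.map σ.toEmbedding) g = expect p F (fun ω => g (σ '' ω)) := by
  classical
  induction F using Finset.induction_on generalizing g with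
  | empty => simp [expect_empty]
  | insert e F he ih =>
    have he' : σ.toEmbedding e ∉ F.map σ.toEmbedding := by simpa using he
    rw [Finset.map_insert, expect_insert p he', expect_insert p he, ih, ih]
    simp only [Set.image_insert_eq, Equiv.coe_toEmbedding]

/-- Increasing functions have increasing expectations. -/
lemma expect_mono_param {p q : ℝ} (h0 : 0 ≤ p) (hpq : p ≤ q) (h1 : q ≤ 1) (F : Finset ι)
    {g : Set ι → ℝ} (hg : Monotone g) : expect p F g ≤ expect q F g := by
  have hd := hasDerivAt_expect F g
  have : MonotoneOn (fun q => expect q F g) (Set.Icc 0 1) := by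
    refine monotoneOn_of_deriv_nonneg (convex_Icc 0 1)
      (fun x _ => (hd x).continuousAt.continuousWithinAt)
      (fun x _ => (hd x).differentiableAt.differentiableWithinAt) fun x hx => ?_
    rw [interior_Icc] at hx
    rw [(hd x).deriv]
    exact Finset.sum_nonneg fun e _ => expect_nonneg hx.1.le hx.2.le _ fun ω =>
      sub_nonneg.2 (hg (Set.sdiff_subset.trans (Set.subset_insert _ _)))
  exact this ⟨h0, hpq.trans h1⟩ ⟨h0.trans hpq, h1⟩ hpq

open Classical in
/-- The real number `1` if `P` holds and `0` otherwise. -/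
noncomputable def ind (P : Prop) : ℝ := if P then 1 else 0

lemma ind_of {P : Prop} (h : P) : ind P = 1 := if_pos h

lemma ind_of_not {P : Prop} (h : ¬P) : ind P = 0 := if_neg h

lemma ind_nonneg (P : Prop) : 0 ≤ ind P := by
  unfold ind; split_ifs <;> norm_num

lemma ind_le_one (P : Prop) : ind P ≤ 1 := by
  unfold ind; split_ifs <;> norm_num

lemma ind_mono {P Q : Prop} (h : P → Q) : ind P ≤ ind Q := by
  by_cases hP : P
  · rw [ind_of hP, ind_of (h hP)]
  · rw [ind_of_not hP]; exact ind_nonneg Q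

open Classical in
lemma sum_ind {α : Type*} (s : Finset α) (P : α → Prop) :
    ∑ a ∈ s, ind (P a) = ((s.filter P).card : ℝ) :=
  Finset.sum_boole P s

/-- The probability of `P` under Bernoulli percolation with parameter `p` on the finite set `F`. -/
noncomputable def prob (p : ℝ) (F : Finset ι) (P : Set ι → Prop) : ℝ :=
  expect p F (fun ω => ind (P ω))

lemma prob_mono {p : ℝ} (h0 : 0 ≤ p) (h1 : p ≤ 1) (F : Finset ι) {P Q : Set ι → Prop}
    (h : ∀ ω, P ω → Q ω) : prob p F P ≤ prob p F Q :=
  expect_mono h0 h1 F fun ω => ind_mono (h ω)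

lemma prob_nonneg {p : ℝ} (h0 : 0 ≤ p) (h1 : p ≤ 1) (F : Finset ι) (P : Set ι → Prop) :
    0 ≤ prob p F P :=
  expect_nonneg h0 h1 F fun _ => ind_nonneg _

lemma prob_le_one {p : ℝ} (h0 : 0 ≤ p) (h1 : p ≤ 1) (F : Finset ι) (P : Set ι → Prop) :
    prob p F P ≤ 1 :=
  (expect_mono h0 h1 F fun _ => ind_le_one _).trans (expect_const p F 1).le

lemma prob_not (p : ℝ) (F : Finset ι) (P : Set ι → Prop) :
    prob p F (fun ω => ¬P ω) = 1 - prob p F P := by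
  have h : (fun ω => ind (¬P ω)) = fun ω => 1 - ind (P ω) := by
    funext ω
    by_cases hP : P ω
    · rw [ind_of hP, ind_of_not (not_not.2 hP)]; ring
    · rw [ind_of_not hP, ind_of hP]; ring
  rw [prob, h, expect_sub, expect_const, prob]

/-- `P` depends only on the coordinates in `F`. -/
def DependsOn (P : Set ι → Prop) (F : Finset ι) : Prop :=
  ∀ ω, P ω ↔ P (ω ∩ F)

open Classical in
lemma setBernoulli_inter_eq (p : unitInterval) (F D : Finset ι) (hD : D ⊆ F) :
    MeasurableSet {ω : Set ι | ω ∩ F = D} ∧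
    (setBernoulli Set.univ p).real {ω : Set ι | ω ∩ F = D} =
      ∏ i ∈ F, if i ∈ D then (p : ℝ) else 1 - p := by
  have hset : {ω : Set ι | ω ∩ F = D} = ⋂ i ∈ F, {ω : Set ι | i ∈ ω ↔ i ∈ D} := by
    ext ω
    simp only [Set.mem_ofPred_eq, Set.mem_iInter, Set.ext_iff, Set.mem_inter_iff, Finset.mem_coe]
    constructor
    · intro h i hi
      rw [← h i]; simp [hi]
    · intro h i
      by_cases hi : i ∈ F
      · simp [hi, h i hi]
      · have : i ∉ D := fun h => hi (hD h)
        simp [hi, this]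
  refine ⟨?_, ?_⟩
  · rw [hset]
    refine Finset.measurableSet_biInter _ fun i _ => ?_
    have : MeasurableSet {ω : Set ι | i ∈ ω} := by measurability
    by_cases hi : i ∈ D
    · simpa [hi] using this
    · simp only [hi, iff_false]
      exact this.compl
  · rw [measureReal_def, setBernoulli_apply']
    have : ((fun q : ι → Prop => {i | q i}) ⁻¹' {ω : Set ι | ω ∩ F = D}) =
        Set.pi F (fun i => {q : Prop | q ↔ i ∈ D}) := by
      rw [hset]
      ext q
      simp [Set.mem_pi]
    rw [this, Measure.infinitePi_pi _ (fun i _ => MeasurableSet.of_discrete), ENNReal.toReal_prod]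
    refine Finset.prod_congr rfl fun i hi => ?_
    by_cases hi : i ∈ D
    · simp [hi]
    · simp [hi]

/-- The bridge from finite sums to the product measure: an event that depends on `F` is a finite
disjoint union of cylinders over `F`. -/
lemma measurableSet_of_dependsOn {P : Set ι → Prop} {F : Finset ι} (hP : DependsOn P F) :
    MeasurableSet {ω | P ω} ∧ ∀ p : unitInterval,
      (setBernoulli Set.univ p).real {ω | P ω} = prob p F P := by
  classical
  have hset : {ω | P ω} =
      ⋃ D ∈ F.powerset.filter (fun D : Finset ι => P D), {ω : Set ι | ω ∩ F = D} := by
    ext ω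
    simp only [Set.mem_iUnion, Finset.mem_filter, Finset.mem_powerset, Set.mem_ofPred_eq,
      exists_prop]
    constructor
    · intro h
      have hfin : (ω ∩ F).Finite := F.finite_toSet.subset Set.inter_subset_right
      refine ⟨hfin.toFinset, ⟨?_, ?_⟩, ?_⟩
      · intro i hi
        exact (hfin.mem_toFinset.1 hi).2
      · simpa using (hP ω).1 h
      · simp
    · rintro ⟨D, ⟨_, hDA⟩, hωD⟩
      rw [hP, hωD]
      exact hDA
  have hm : ∀ D ∈ F.powerset.filter (fun D : Finset ι => P D),
      MeasurableSet {ω : Set ι | ω ∩ F = D} := fun D hD =>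
    (setBernoulli_inter_eq 0 F D (Finset.mem_powerset.1 (Finset.mem_filter.1 hD).1)).1
  refine ⟨?_, fun p => ?_⟩
  · rw [hset]
    exact Finset.measurableSet_biUnion _ hm
  · rw [hset, measureReal_biUnion_finset _ hm]
    · rw [Finset.sum_filter, prob, expect]
      refine Finset.sum_congr rfl fun D hD => ?_
      rw [(setBernoulli_inter_eq p F D (Finset.mem_powerset.1 hD)).2]
      by_cases h : P D <;> simp [h, ind]
    · intro D _ D' _ hne
      refine Set.disjoint_left.2 fun ω h h' => hne ?_
      have h2 : (D : Set ι) = D' := h.symm.trans h'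
      exact Finset.coe_injective h2

end Bernoulli

/-! ### Open paths in finite vertex sets and the Duminil-Copin–Tassion inequality. -/

section Graph

variable {V : Type*} {G : SimpleGraph V}

/-- `a` and `b` are vertices in `S` joined by an open edge. -/
def OpenStep (ω : Set G.edgeSet) (S : Set V) (a b : V) : Prop :=
  a ∈ S ∧ b ∈ S ∧ ∃ h : G.Adj a b, (⟨s(a, b), G.mem_edgeSet.2 h⟩ : G.edgeSet) ∈ ω

/-- `a` and `b` are joined by an open path through vertices in `S`. -/
def Conn (ω : Set G.edgeSet) (S : Set V) : V → V → Prop :=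
  Relation.ReflTransGen (OpenStep ω S)

lemma OpenStep.symm {ω : Set G.edgeSet} {S : Set V} {a b : V} (h : OpenStep ω S a b) :
    OpenStep ω S b a := by
  obtain ⟨ha, hb, hab, he⟩ := h
  refine ⟨hb, ha, hab.symm, ?_⟩
  have : (⟨s(b, a), G.mem_edgeSet.2 hab.symm⟩ : G.edgeSet) = ⟨s(a, b), G.mem_edgeSet.2 hab⟩ :=
    Subtype.ext Sym2.eq_swap
  rwa [this]

lemma OpenStep.mono {ω ω' : Set G.edgeSet} {S S' : Set V} {a b : V} (hω : ω ⊆ ω') (hS : S ⊆ S')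
    (h : OpenStep ω S a b) : OpenStep ω' S' a b :=
  ⟨hS h.1, hS h.2.1, h.2.2.imp fun _ he => hω he⟩

lemma Conn.symm {ω : Set G.edgeSet} {S : Set V} {a b : V} (h : Conn ω S a b) : Conn ω S b a := by
  induction h with
  | refl => exact Relation.ReflTransGen.refl
  | tail _ h ih => exact ih.head h.symm

lemma Conn.mono {ω ω' : Set G.edgeSet} {S S' : Set V} {a b : V} (hω : ω ⊆ ω') (hS : S ⊆ S')
    (h : Conn ω S a b) : Conn ω' S' a b :=
  Relation.ReflTransGen.mono (fun _ _ => OpenStep.mono hω hS) _ _ h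

lemma Conn.mem {ω : Set G.edgeSet} {S : Set V} {a b : V} (h : Conn ω S a b) (ha : a ∈ S) :
    b ∈ S := by
  induction h with
  | refl => exact ha
  | tail _ h _ => exact h.2.1

lemma openStep_insert {ω : Set G.edgeSet} {S : Set V} {e : G.edgeSet}
    (he : ∃ v ∈ (e : Sym2 V), v ∉ S) : OpenStep (insert e ω) S = OpenStep ω S := by
  funext a b
  refine propext ⟨?_, OpenStep.mono (Set.subset_insert _ _) subset_rfl⟩
  rintro ⟨ha, hb, hab, h⟩
  refine ⟨ha, hb, hab, h.resolve_left ?_⟩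
  rintro rfl
  obtain ⟨v, hv, hvS⟩ := he
  rcases Sym2.mem_iff.1 hv with rfl | rfl
  · exact hvS ha
  · exact hvS hb

/-- A path inside `S` cannot use an edge with an endpoint off `S`. With `reach_insert_eq_iff` this
supplies the independence of a cluster and the connections off it. -/
lemma conn_insert {ω : Set G.edgeSet} {S : Set V} {e : G.edgeSet}
    (he : ∃ v ∈ (e : Sym2 V), v ∉ S) : Conn (insert e ω) S = Conn ω S := by
  unfold Conn
  rw [openStep_insert he]

/-- The set of vertices joined to `R` by open paths in `S`. -/
def reach (ω : Set G.edgeSet) (S R : Set V) : Set V := {z | ∃ r ∈ R, Conn ω S r z}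

lemma subset_reach (ω : Set G.edgeSet) (S R : Set V) : R ⊆ reach ω S R :=
  fun r hr => ⟨r, hr, Relation.ReflTransGen.refl⟩

lemma reach_subset {ω : Set G.edgeSet} {S R : Set V} (hR : R ⊆ S) : reach ω S R ⊆ S := by
  rintro z ⟨r, hr, h⟩
  exact h.mem (hR hr)

/-- Exploring the cluster from `R` queries only edges at vertices of `C`, so configurations that
agree on those edges produce the same cluster. -/
lemma reach_eq_of_agree {ω ω' : Set G.edgeSet} {S R C : Set V}
    (h : ∀ a ∈ C, ∀ b, ∀ hab : G.Adj a b, (⟨s(a, b), G.mem_edgeSet.2 hab⟩ : G.edgeSet) ∈ ω ↔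
      (⟨s(a, b), G.mem_edgeSet.2 hab⟩ : G.edgeSet) ∈ ω')
    (hC : reach ω S R = C) : reach ω' S R = C := by
  apply Set.Subset.antisymm
  · rintro z ⟨r, hr, hz⟩
    induction hz with
    | refl => exact hC ▸ subset_reach ω S R hr
    | @tail b c _ hbc ih =>
      obtain ⟨hb, hc, hab, he⟩ := hbc
      have hbc' : OpenStep ω S b c := ⟨hb, hc, hab, (h b ih c hab).2 he⟩
      rw [← hC] at ih ⊢
      obtain ⟨r', hr', hz'⟩ := ih
      exact ⟨r', hr', hz'.tail hbc'⟩
  · intro z hz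
    rw [← hC] at hz
    obtain ⟨r, hr, hz⟩ := hz
    suffices Conn ω' S r z from ⟨r, hr, this⟩
    induction hz with
    | refl => exact Relation.ReflTransGen.refl
    | @tail b c hb hbc ih =>
      obtain ⟨hbS, hcS, hab, he⟩ := hbc
      have hbC : b ∈ C := hC ▸ ⟨r, hr, hb⟩
      exact ih.tail ⟨hbS, hcS, hab, (h b hbC c hab).1 he⟩

/-- Whether the cluster of `R` is `C` does not depend on edges that do not touch `C`. -/
lemma reach_insert_eq_iff {ω : Set G.edgeSet} {S R C : Set V} {e : G.edgeSet}
    (he : ∀ v ∈ (e : Sym2 V), v ∉ C) : reach (insert e ω) S R = C ↔ reach ω S R = C := by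
  have h : ∀ a ∈ C, ∀ b, ∀ hab : G.Adj a b,
      (⟨s(a, b), G.mem_edgeSet.2 hab⟩ : G.edgeSet) ∈ insert e ω ↔
      (⟨s(a, b), G.mem_edgeSet.2 hab⟩ : G.edgeSet) ∈ ω := by
    intro a ha b hab
    refine ⟨fun h => h.resolve_left ?_, fun h => Or.inr h⟩
    rintro rfl
    exact he a (Sym2.mem_mk_left a b) ha
  exact ⟨reach_eq_of_agree h, reach_eq_of_agree fun a ha b hab => (h a ha b hab).symm⟩

/-- A path from `z` to a point off `C` avoids `C` after its last visit there. -/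
lemma exists_last_exit {ω : Set G.edgeSet} {W C : Set V} {z t : V} (h : Conn ω W z t)
    (ht : t ∉ C) :
    (z ∉ C ∧ Conn ω (W \ C) z t) ∨
      ∃ x ∈ C, ∃ y ∉ C, OpenStep ω W x y ∧ Conn ω (W \ C) y t := by
  induction h using Relation.ReflTransGen.head_induction_on with
  | refl => exact Or.inl ⟨ht, Relation.ReflTransGen.refl⟩
  | @head a b hab _ ih =>
    rcases ih with ⟨hb, hbt⟩ | h
    · by_cases ha : a ∈ C
      · exact Or.inr ⟨a, ha, b, hb, hab, hbt⟩
      · exact Or.inl ⟨ha, Relation.ReflTransGen.head ⟨⟨hab.1, ha⟩, ⟨hab.2.1, hb⟩, hab.2.2⟩ hbt⟩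
    · exact Or.inr h

open Classical in
variable (G) in
/-- The edges of `G` with both endpoints in `W`. -/
noncomputable def edgesIn (W : Finset V) : Finset G.edgeSet :=
  W.sym2.subtype (· ∈ G.edgeSet)

lemma mem_edgesIn {W : Finset V} {e : G.edgeSet} :
    e ∈ edgesIn G W ↔ ∀ v ∈ (e : Sym2 V), v ∈ W := by
  simp [edgesIn, Finset.mem_sym2_iff]

lemma conn_inter_edgesIn {W : Finset V} {ω : Set G.edgeSet} {a b : V} :
    Conn (ω ∩ edgesIn G W) W a b ↔ Conn ω W a b := by
  refine ⟨Conn.mono Set.inter_subset_left subset_rfl, Relation.ReflTransGen.mono ?_ _ _⟩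
  rintro x y ⟨hx, hy, hxy, he⟩
  refine ⟨hx, hy, hxy, he, ?_⟩
  rw [Finset.mem_coe, mem_edgesIn]
  intro v hv
  rcases Sym2.mem_iff.1 hv with rfl | rfl
  · exact hx
  · exact hy

/-- The event that `v` is joined to `T` by an open path in `W`. -/
def JoinedIn (W : Set V) (v : V) (T : Set V) (ω : Set G.edgeSet) : Prop :=
  ∃ t ∈ T, Conn ω W v t

lemma dependsOn_joinedIn (W : Finset V) (v : V) (T : Set V) :
    DependsOn (JoinedIn (G := G) W v T) (edgesIn G W) := fun _ =>
  exists_congr fun _ => and_congr_right fun _ => conn_inter_edgesIn.symm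

lemma JoinedIn.mono {W W' : Set V} {v : V} {T T' : Set V} {ω ω' : Set G.edgeSet} (hW : W ⊆ W')
    (hT : T ⊆ T') (hω : ω ⊆ ω') (h : JoinedIn W v T ω) : JoinedIn W' v T' ω' := by
  obtain ⟨t, ht, h⟩ := h
  exact ⟨t, hT ht, h.mono hω hW⟩

open Classical in
variable (G) in
/-- The pairs `(x, y)` of adjacent vertices with `x ∈ S` and `y ∈ W \ S`. -/
noncomputable def bdryPairs (W S : Finset V) : Finset (V × V) :=
  (S ×ˢ (W \ S)).filter fun q => G.Adj q.1 q.2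

lemma mem_bdryPairs {W S : Finset V} {q : V × V} :
    q ∈ bdryPairs G W S ↔ q.1 ∈ S ∧ q.2 ∈ W ∧ q.2 ∉ S ∧ G.Adj q.1 q.2 := by
  simp [bdryPairs, and_assoc]

open Classical in
/-- Decomposition of the event that `v` is joined to `T` according to the cluster of `v` in `S`. -/
lemma prob_joinedIn_le {p : ℝ} (h0 : 0 ≤ p) (h1 : p ≤ 1) {W S : Finset V} {v : V}
    (hv : v ∈ S) {T : Set V} (hT : Disjoint (S : Set V) T) :
    prob p (edgesIn G W) (JoinedIn W v T) ≤
      ∑ q ∈ bdryPairs G W S, prob p (edgesIn G W) (fun ω => Conn ω S v q.1) *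
        prob p (edgesIn G W) (JoinedIn W q.2 T) := by
  set F := edgesIn G W
  -- Let `C` be the cluster of `v` in `S` and `(x, y)` the last step of the path out of `C`; from
  -- `y` on, the path avoids `C`.
  have key : ∀ ω : Set G.edgeSet, ind (JoinedIn (W : Set V) v T ω) ≤
      ∑ q ∈ bdryPairs G W S, ∑ C ∈ S.powerset.filter (fun C => q.1 ∈ C),
        ind (reach ω S {v} = C) * ind (JoinedIn ((W : Set V) \ C) q.2 T ω) := by
    intro ω
    have hnn : ∀ q ∈ bdryPairs G W S, 0 ≤ ∑ C ∈ S.powerset.filter (fun C => q.1 ∈ C),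
        ind (reach ω S {v} = C) * ind (JoinedIn ((W : Set V) \ C) q.2 T ω) := fun q _ =>
      Finset.sum_nonneg fun C _ => mul_nonneg (ind_nonneg _) (ind_nonneg _)
    by_cases hω : JoinedIn (W : Set V) v T ω
    swap
    · rw [ind_of_not hω]
      exact Finset.sum_nonneg hnn
    rw [ind_of hω]
    obtain ⟨t, ht, hvt⟩ := hω
    have hsub : reach ω (S : Set V) {v} ⊆ S := reach_subset (by simpa using hv)
    have hfin : (reach ω (S : Set V) {v}).Finite := S.finite_toSet.subset hsub
    obtain ⟨C, hC⟩ : ∃ C : Finset V, (C : Set V) = reach ω (S : Set V) {v} :=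
      ⟨hfin.toFinset, by simp⟩
    have hCS : C ⊆ S := by
      intro z hz
      exact hsub (hC ▸ Finset.mem_coe.2 hz)
    have htC : t ∉ (C : Set V) := fun h => Set.disjoint_left.1 hT (hCS h) ht
    have hvC : v ∈ (C : Set V) := hC ▸ subset_reach _ _ _ rfl
    rcases exists_last_exit hvt htC with ⟨h, _⟩ | ⟨x, hx, y, hy, hxy, hyt⟩
    · exact absurd hvC h
    -- If `y` were in `S`, the open edge from `x` would put it into `C`.
    have hyS : y ∉ S := by
      intro hyS
      apply hy
      rw [hC] at hx ⊢
      obtain ⟨r, hr, hrx⟩ := hx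
      exact ⟨r, hr, hrx.tail ⟨hCS (by rw [← Finset.mem_coe, hC]; exact ⟨r, hr, hrx⟩), hyS,
        hxy.2.2⟩⟩
    have hq : (x, y) ∈ bdryPairs G W S := mem_bdryPairs.2 ⟨hCS hx, hxy.2.1, hyS, hxy.2.2.choose⟩
    refine le_trans ?_ (Finset.single_le_sum hnn hq)
    have hCm : C ∈ S.powerset.filter (fun C => (x, y).1 ∈ C) := by
      simpa using ⟨hCS, hx⟩
    refine le_trans ?_ (Finset.single_le_sum
      (fun C _ => mul_nonneg (ind_nonneg _) (ind_nonneg _)) hCm)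
    rw [ind_of hC.symm, ind_of ⟨t, ht, hyt⟩, one_mul]
  refine (expect_mono h0 h1 F key).trans ?_
  rw [expect_sum]
  refine Finset.sum_le_sum fun q _ => ?_
  rw [expect_sum]
  have hind : ∀ C ∈ S.powerset.filter (fun C => q.1 ∈ C),
      expect p F (fun ω => ind (reach ω S {v} = C) * ind (JoinedIn ((W : Set V) \ C) q.2 T ω)) ≤
      prob p F (fun ω => reach ω S {v} = C) * prob p F (JoinedIn W q.2 T) := by
    intro C _
    rw [expect_mul]
    · exact mul_le_mul_of_nonneg_left
        (prob_mono h0 h1 F fun ω => JoinedIn.mono Set.sdiff_subset subset_rfl subset_rfl)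
        (prob_nonneg h0 h1 F _)
    · intro e _
      -- Edges that touch `C` are irrelevant to connections off `C`; all other edges are irrelevant
      -- to the event that the cluster is `C`.
      by_cases he : ∃ u ∈ (e : Sym2 V), u ∈ C
      · obtain ⟨u, hu, huC⟩ := he
        right
        intro ω
        simp only [JoinedIn]
        rw [conn_insert ⟨u, hu, fun h => h.2 huC⟩]
      · left
        intro ω
        rw [reach_insert_eq_iff]
        intro u hu huC
        exact he ⟨u, hu, huC⟩
  refine (Finset.sum_le_sum hind).trans ?_
  rw [← Finset.sum_mul]
  refine mul_le_mul_of_nonneg_right ?_ (prob_nonneg h0 h1 F _)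
  simp only [prob]
  rw [← expect_sum]
  -- At most one `C` is the cluster, and it contains `q.1` only if `v` is joined to `q.1` in `S`.
  refine expect_mono h0 h1 F fun ω => ?_
  by_cases hc : Conn ω S v q.1
  · rw [ind_of hc]
    by_cases hex : ∃ C ∈ S.powerset.filter (fun C => q.1 ∈ C), reach ω S {v} = C
    · obtain ⟨C, hCm, hC⟩ := hex
      rw [Finset.sum_eq_single_of_mem C hCm]
      · exact ind_le_one _
      · intro C' _ hne
        refine ind_of_not fun h => hne ?_
        exact Finset.coe_injective (h.symm.trans hC)
    · refine le_trans (Finset.sum_nonpos fun C hC => ?_) zero_le_one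
      rw [ind_of_not fun h => hex ⟨C, hC, h⟩]
  · rw [ind_of_not hc]
    refine Finset.sum_nonpos fun C hC => ?_
    rw [ind_of_not]
    intro h
    apply hc
    have : q.1 ∈ (C : Set V) := (Finset.mem_filter.1 hC).2
    rw [← h] at this
    obtain ⟨r, hr, hrq⟩ := this
    rwa [← Set.mem_singleton_iff.1 hr]

open Classical in
/-- On the event that `o` is not joined to `T`, every edge that joins a vertex `x` connected to `o`
off the cluster of `T` to that cluster is pivotal. -/
lemma card_pivotal_ge (W : Finset V) {o : V} {T : Set V} {ω : Set G.edgeSet}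
    (hω : ¬JoinedIn W o T ω) {Z : Finset V} (hZ : (Z : Set V) = reach ω W T) :
    ((bdryPairs G W (W \ Z)).filter fun q => Conn ω ((W \ Z : Finset V) : Set V) o q.1).card ≤
      ((edgesIn G W).filter fun e =>
        JoinedIn W o T (insert e ω) ∧ ¬JoinedIn W o T (ω \ {e})).card := by
  refine Finset.card_le_card_of_forall_subsingleton (fun (q : V × V) (e : G.edgeSet) => s(q.1, q.2) = (e : Sym2 V))
    ?_ ?_
  · rintro ⟨x, y⟩ hq
    obtain ⟨hq, hox⟩ := Finset.mem_filter.1 hq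
    obtain ⟨hx, hy, hyS, hxy⟩ := mem_bdryPairs.1 hq
    simp only at hx hy hyS hxy hox
    rw [Finset.mem_sdiff] at hx
    have hyZ : y ∈ (Z : Set V) := by
      by_contra h
      exact hyS (Finset.mem_sdiff.2 ⟨hy, h⟩)
    rw [hZ] at hyZ
    obtain ⟨t, ht, hty⟩ := hyZ
    refine ⟨⟨s(x, y), G.mem_edgeSet.2 hxy⟩, ?_, rfl⟩
    refine Finset.mem_filter.2 ⟨mem_edgesIn.2 fun v hv => ?_, ⟨t, ht, ?_⟩, ?_⟩
    · rcases Sym2.mem_iff.1 hv with rfl | rfl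
      · exact hx.1
      · exact hy
    · have h1 := hox.mono (Set.subset_insert ⟨s(x, y), G.mem_edgeSet.2 hxy⟩ ω)
        (Finset.coe_subset.2 (Finset.sdiff_subset (s := W) (t := Z)))
      exact (h1.tail ⟨hx.1, hy, hxy, Set.mem_insert _ _⟩).trans
        (hty.symm.mono (Set.subset_insert _ _) subset_rfl)
    · exact fun h => hω (h.mono subset_rfl subset_rfl Set.sdiff_subset)
  · rintro e _ ⟨x, y⟩ ⟨hq, he⟩ ⟨x', y'⟩ ⟨hq', he'⟩
    obtain ⟨hx, _, hy, _⟩ := mem_bdryPairs.1 (Finset.mem_filter.1 hq).1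
    obtain ⟨hx', _, hy', _⟩ := mem_bdryPairs.1 (Finset.mem_filter.1 hq').1
    rcases Sym2.eq_iff.1 (he.trans he'.symm) with ⟨h1, h2⟩ | ⟨h1, h2⟩
    · exact Prod.ext h1 h2
    -- An edge determines its pair: the first vertex lies in `W \ Z` and the second does not, so the
    -- reversed orientation is impossible.
    · simp only at h1 h2 hx hy'
      exact absurd (h1 ▸ hx) hy'

variable (G) in
/-- The expected number of pairs `(x, y)` with `x ∈ S` joined to `v` in `S` and `y ∈ W \ S` adjacent
to `x`. -/
noncomputable def bdrySum (p : ℝ) (W S : Finset V) (v : V) : ℝ :=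
  ∑ q ∈ bdryPairs G W S, prob p (edgesIn G W) (fun ω => Conn ω S v q.1)

lemma bdrySum_mono {p q : ℝ} (h0 : 0 ≤ p) (hpq : p ≤ q) (h1 : q ≤ 1) (W S : Finset V) (v : V) :
    bdrySum G p W S v ≤ bdrySum G q W S v :=
  Finset.sum_le_sum fun _ _ => expect_mono_param h0 hpq h1 _ fun _ _ hω =>
    ind_mono (Conn.mono hω subset_rfl)

open Classical in
/-- The differential inequality for the probability that `o` is joined to `T`. -/
lemma deriv_prob_joinedIn_ge {p : ℝ} (h0 : 0 ≤ p) (h1 : p ≤ 1) {W : Finset V} {o : V}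
    (ho : o ∈ W) {T : Set V} (hT : T ⊆ W) {c : ℝ}
    (hc : ∀ S ⊆ W, o ∈ S → Disjoint (S : Set V) T → c ≤ bdrySum G p W S o) :
    c * (1 - prob p (edgesIn G W) (JoinedIn W o T)) ≤
      ∑ e ∈ edgesIn G W, expect p (edgesIn G W) (fun ω =>
        ind (JoinedIn W o T (insert e ω)) - ind (JoinedIn W o T (ω \ {e}))) := by
  set F := edgesIn G W
  -- The candidates for the cluster of `T` when it misses `o`.
  set 𝒵 := W.powerset.filter fun Z : Finset V => T ⊆ Z ∧ o ∉ Z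
  have hreach : ∀ ω : Set G.edgeSet, ¬JoinedIn W o T ω →
      ∃ Z ∈ 𝒵, (Z : Set V) = reach ω W T := by
    intro ω hω
    have hfin : (reach ω (W : Set V) T).Finite := W.finite_toSet.subset (reach_subset hT)
    refine ⟨hfin.toFinset, ?_, by simp⟩
    simp only [𝒵, Finset.mem_filter, Finset.mem_powerset, Set.Finite.coe_toFinset,
      Set.Finite.mem_toFinset]
    refine ⟨?_, subset_reach _ _ _, ?_⟩
    · intro z hz
      exact reach_subset hT (hfin.mem_toFinset.1 hz)
    · rintro ⟨t, ht, h⟩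
      exact hω ⟨t, ht, h.symm⟩
  have hdiff : ∀ (ω : Set G.edgeSet) (e : G.edgeSet),
      ind (JoinedIn (W : Set V) o T (insert e ω) ∧ ¬JoinedIn (W : Set V) o T (ω \ {e})) ≤
        ind (JoinedIn (W : Set V) o T (insert e ω)) - ind (JoinedIn (W : Set V) o T (ω \ {e})) := by
    intro ω e
    have hm : JoinedIn (W : Set V) o T (ω \ {e}) → JoinedIn (W : Set V) o T (insert e ω) :=
      JoinedIn.mono subset_rfl subset_rfl (Set.sdiff_subset.trans (Set.subset_insert _ _))
    by_cases ha : JoinedIn (W : Set V) o T (insert e ω) <;>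
      by_cases hb : JoinedIn (W : Set V) o T (ω \ {e})
    · simp [ind, ha, hb]
    · simp [ind, ha, hb]
    · exact absurd (hm hb) ha
    · simp [ind, ha, hb]
  have key : ∀ ω : Set G.edgeSet,
      ∑ Z ∈ 𝒵, ∑ q ∈ bdryPairs G W (W \ Z),
        ind (reach ω W T = Z) * ind (Conn ω ((W \ Z : Finset V) : Set V) o q.1) ≤
      ∑ e ∈ F, (ind (JoinedIn (W : Set V) o T (insert e ω)) -
        ind (JoinedIn (W : Set V) o T (ω \ {e}))) := by
    intro ω
    refine le_trans ?_ (Finset.sum_le_sum fun e _ => hdiff ω e)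
    by_cases hω : JoinedIn (W : Set V) o T ω
    · refine le_trans (Finset.sum_nonpos fun Z hZ => Finset.sum_nonpos fun q _ => ?_)
        (Finset.sum_nonneg fun e _ => ind_nonneg _)
      rw [ind_of_not, zero_mul]
      intro h
      obtain ⟨t, ht, hot⟩ := hω
      have : o ∈ (Z : Set V) := h ▸ ⟨t, ht, hot.symm⟩
      exact (Finset.mem_filter.1 hZ).2.2 this
    · obtain ⟨Z, hZm, hZ⟩ := hreach ω hω
      rw [Finset.sum_eq_single_of_mem Z hZm]
      · have := card_pivotal_ge W hω hZ
        rw [ind_of hZ.symm]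
        simp only [one_mul]
        rw [sum_ind, sum_ind]
        refine Nat.cast_le.2 (this.trans (le_of_eq ?_))
        congr!
      · intro Z' _ hne
        refine Finset.sum_eq_zero fun q _ => ?_
        rw [ind_of_not, zero_mul]
        exact fun h => hne (Finset.coe_injective (h.symm.trans hZ.symm))
  have hsum := expect_mono h0 h1 F key
  rw [expect_sum, expect_sum] at hsum
  refine le_trans ?_ hsum
  -- Given that the cluster of `T` is `Z`, the edges inside `W \ Z` are still independent of this
  -- information, and `hc` applies to `S = W \ Z`.
  have hZterm : ∀ Z ∈ 𝒵, c * prob p F (fun ω => reach ω W T = Z) ≤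
      expect p F (fun ω => ∑ q ∈ bdryPairs G W (W \ Z),
        ind (reach ω W T = Z) * ind (Conn ω ((W \ Z : Finset V) : Set V) o q.1)) := by
    intro Z hZ
    obtain ⟨_, hTZ, hoZ⟩ := Finset.mem_filter.1 hZ
    have hdisj : Disjoint ((W \ Z : Finset V) : Set V) T := by
      rw [Set.disjoint_left]
      intro z hz hzT
      exact (Finset.mem_sdiff.1 (Finset.mem_coe.1 hz)).2 (hTZ hzT)
    have h := hc (W \ Z) Finset.sdiff_subset (Finset.mem_sdiff.2 ⟨ho, hoZ⟩) hdisj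
    rw [expect_sum, mul_comm]
    refine (mul_le_mul_of_nonneg_left h (prob_nonneg h0 h1 F _)).trans ?_
    rw [bdrySum, Finset.mul_sum]
    refine Finset.sum_le_sum fun q _ => ?_
    rw [expect_mul]
    · exact le_rfl
    · intro e _
      by_cases he : ∃ u ∈ (e : Sym2 V), u ∈ Z
      · obtain ⟨u, hu, huZ⟩ := he
        right
        intro ω
        rw [conn_insert ⟨u, hu, fun h => (Finset.mem_sdiff.1 (Finset.mem_coe.1 h)).2 huZ⟩]
      · left
        intro ω
        rw [reach_insert_eq_iff]
        intro u hu huZ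
        exact he ⟨u, hu, huZ⟩
  refine le_trans ?_ (Finset.sum_le_sum hZterm)
  rw [← Finset.mul_sum, ← prob_not]
  have heq : prob p F (fun ω => ¬JoinedIn (W : Set V) o T ω) =
      ∑ Z ∈ 𝒵, prob p F (fun ω => reach ω W T = Z) := by
    simp only [prob]
    rw [← expect_sum]
    congr 1
    funext ω
    by_cases hω : JoinedIn (W : Set V) o T ω
    · rw [ind_of_not (not_not.2 hω)]
      refine (Finset.sum_eq_zero fun Z hZ => ind_of_not fun h => ?_).symm
      obtain ⟨t, ht, hot⟩ := hω
      have : o ∈ (Z : Set V) := h ▸ ⟨t, ht, hot.symm⟩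
      exact (Finset.mem_filter.1 hZ).2.2 this
    · rw [ind_of hω]
      obtain ⟨Z, hZm, hZ⟩ := hreach ω hω
      rw [Finset.sum_eq_single_of_mem Z hZm, ind_of hZ.symm]
      intro Z' _ hne
      exact ind_of_not fun h => hne (Finset.coe_injective (h.symm.trans hZ.symm))
  rw [heq]

/-- If the boundary sums at `p` are bounded below, then at every `q > p` the probability that `o` is
joined to `T` is bounded below. -/
lemma prob_joinedIn_ge {p q : ℝ} (h0 : 0 ≤ p) (hpq : p ≤ q) (h1 : q ≤ 1) {W : Finset V} {o : V}
    (ho : o ∈ W) {T : Set V} (hT : T ⊆ W) {c : ℝ}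
    (hc : ∀ S ⊆ W, o ∈ S → Disjoint (S : Set V) T → c ≤ bdrySum G p W S o) :
    1 - Real.exp (-(c * (q - p))) ≤ prob q (edgesIn G W) (JoinedIn W o T) := by
  set f : ℝ → ℝ := fun x => prob x (edgesIn G W) (JoinedIn W o T)
  have hd := hasDerivAt_expect (edgesIn G W) (fun ω => ind (JoinedIn (W : Set V) o T ω))
  have hh : ∀ x, HasDerivAt (fun x => (1 - f x) * Real.exp (c * (x - p)))
      ((-(∑ e ∈ edgesIn G W, expect x (edgesIn G W) (fun ω =>
        ind (JoinedIn W o T (insert e ω)) - ind (JoinedIn W o T (ω \ {e}))))) *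
        Real.exp (c * (x - p)) + (1 - f x) * (Real.exp (c * (x - p)) * c)) x := by
    intro x
    have he : HasDerivAt (fun x => Real.exp (c * (x - p))) (Real.exp (c * (x - p)) * c) x := by
      have := (((hasDerivAt_id x).sub_const p).const_mul c).exp
      simpa using this
    exact ((hd x).const_sub 1).mul he
  -- The inequality `f' ≥ c (1 - f)` in integrated form; monotonicity of `bdrySum` in the parameter
  -- extends `hc` from `p` to all of `[p, q]`.
  have hanti : AntitoneOn (fun x => (1 - f x) * Real.exp (c * (x - p))) (Set.Icc p q) := by
    refine antitoneOn_of_deriv_nonpos (convex_Icc p q)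
      (fun x _ => (hh x).continuousAt.continuousWithinAt)
      (fun x _ => (hh x).differentiableAt.differentiableWithinAt) fun x hx => ?_
    rw [interior_Icc] at hx
    rw [(hh x).deriv]
    have hx0 : 0 ≤ x := h0.trans hx.1.le
    have hx1 : x ≤ 1 := hx.2.le.trans h1
    have := deriv_prob_joinedIn_ge hx0 hx1 ho hT fun S hS hoS hd =>
      (hc S hS hoS hd).trans (bdrySum_mono h0 hx.1.le hx1 W S o)
    have hpos := Real.exp_pos (c * (x - p))
    nlinarith [mul_le_mul_of_nonneg_right this hpos.le]
  have h := hanti (Set.left_mem_Icc.2 hpq) (Set.right_mem_Icc.2 hpq) hpq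
  simp only [sub_self, mul_zero, Real.exp_zero, mul_one] at h
  have hfp : 0 ≤ f p := prob_nonneg h0 (hpq.trans h1) _ _
  have hpos := Real.exp_pos (-(c * (q - p)))
  have hmul : Real.exp (c * (q - p)) * Real.exp (-(c * (q - p))) = 1 := by
    rw [← Real.exp_add]; simp
  have h2 : (1 - f q) * Real.exp (c * (q - p)) ≤ 1 := h.trans (by linarith)
  have h3 := mul_le_mul_of_nonneg_right h2 hpos.le
  rw [mul_assoc, hmul] at h3
  linarith

end Graph

/-! ### Iterating the exit estimate, and transport of paths. -/

section Iteration

variable {V : Type*} {G : SimpleGraph V}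

/-- Exponential decay of connection probabilities in a subset `L` of a graph with a semimetric `D`,
when every vertex has a set of bounded size with a small boundary sum. -/
lemma prob_joinedIn_le_pow {p : ℝ} (h0 : 0 ≤ p) (h1 : p ≤ 1) {L : Set V} {D : V → V → ℝ}
    (htri : ∀ x y z, D x z ≤ D x y + D y z) {K ℓ : ℝ} (hK : 0 ≤ K)
    (hadj : ∀ x ∈ L, ∀ y ∈ L, G.Adj x y → D x y ≤ K)
    (hS : ∀ v ∈ L, ∀ W : Finset V, (W : Set V) ⊆ L → v ∈ W → ∃ S ⊆ W, v ∈ S ∧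
      (∀ u ∈ S, D v u < ℓ) ∧ bdrySum G p W S v ≤ 1 / 2) (hℓ : 0 ≤ ℓ)
    (m : ℕ) (r : ℝ) (hr : m * (ℓ + K) ≤ r) (v : V) (W : Finset V) (hW : (W : Set V) ⊆ L)
    (hv : v ∈ W) :
    prob p (edgesIn G W) (JoinedIn W v {u | r ≤ D v u}) ≤ (1 / 2) ^ m := by
  induction m generalizing r v with
  | zero => simpa using prob_le_one h0 h1 _ _
  | succ m ih =>
    obtain ⟨S, hSW, hvS, hSℓ, hsum⟩ := hS v (hW hv) W hW hv
    push_cast at hr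
    have hm : 0 ≤ (m : ℝ) * (ℓ + K) := by positivity
    have hrr : m * (ℓ + K) ≤ r - (ℓ + K) := by linarith
    have hdisj : Disjoint (S : Set V) {u | r ≤ D v u} := by
      rw [Set.disjoint_left]
      intro u hu hur
      have := hSℓ u hu
      have h2 : r ≤ D v u := hur
      linarith
    refine (prob_joinedIn_le h0 h1 hvS hdisj).trans ?_
    have hterm : ∀ q ∈ bdryPairs G W S,
        prob p (edgesIn G W) (fun ω => Conn ω S v q.1) *
          prob p (edgesIn G W) (JoinedIn W q.2 {u | r ≤ D v u}) ≤
        prob p (edgesIn G W) (fun ω => Conn ω S v q.1) * (1 / 2) ^ m := by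
      intro q hq
      obtain ⟨hx, hy, _, hxy⟩ := mem_bdryPairs.1 hq
      refine mul_le_mul_of_nonneg_left ?_ (prob_nonneg h0 h1 _ _)
      -- The exit vertex `q.2` is within `ℓ + K` of `v`, so distance `r - (ℓ + K)` remains to be
      -- covered from there.
      refine (prob_mono h0 h1 _ fun ω => JoinedIn.mono subset_rfl ?_ subset_rfl).trans
        (ih (r - (ℓ + K)) hrr q.2 hy)
      intro u hu
      have h2 : r ≤ D v u := hu
      have h3 := hSℓ _ hx
      have h4 := hadj _ (hW (hSW hx)) _ (hW hy) hxy
      have h5 := htri v q.2 u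
      have h6 := htri v q.1 q.2
      change r - (ℓ + K) ≤ D q.2 u
      linarith
    refine (Finset.sum_le_sum hterm).trans ?_
    rw [← Finset.sum_mul, pow_succ, mul_comm ((1 / 2 : ℝ) ^ m)]
    exact mul_le_mul_of_nonneg_right hsum (by positivity)

/-- An open path lies in a finite set of vertices. -/
lemma exists_finset_conn {ω : Set G.edgeSet} {L : Set V} {a b : V} (ha : a ∈ L)
    (h : Conn ω L a b) : ∃ W : Finset V, (W : Set V) ⊆ L ∧ a ∈ W ∧ Conn ω W a b := by
  classical
  induction h with
  | refl => exact ⟨{a}, by simpa using ha, by simp, Relation.ReflTransGen.refl⟩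
  | @tail b c _ hbc ih =>
    obtain ⟨W, hW, haW, hab⟩ := ih
    refine ⟨insert c W, ?_, Finset.mem_insert_of_mem haW, ?_⟩
    · rw [Finset.coe_insert]
      exact Set.insert_subset hbc.2.1 hW
    · have hsub : (W : Set V) ⊆ (insert c W : Finset V) := by
        rw [Finset.coe_insert]; exact Set.subset_insert _ _
      exact (hab.mono subset_rfl hsub).tail ⟨hsub (hab.mem haW), by simp, hbc.2.2⟩

lemma conn_of_conn_image (φ : G ≃g G) {ω : Set G.edgeSet} {W : Set V} {a b : V}
    (h : Conn (φ.mapEdgeSet '' ω) W a b) : Conn ω Set.univ (φ.symm a) (φ.symm b) := by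
  induction h with
  | refl => exact Relation.ReflTransGen.refl
  | @tail b c _ hbc ih =>
    obtain ⟨_, _, hadj, e, he, heq⟩ := hbc
    have hadj' : G.Adj (φ.symm b) (φ.symm c) := φ.symm.map_adj_iff.2 hadj
    refine ih.tail ⟨trivial, trivial, hadj', ?_⟩
    have : e = ⟨s(φ.symm b, φ.symm c), G.mem_edgeSet.2 hadj'⟩ := by
      apply φ.mapEdgeSet.injective
      rw [heq]
      apply Subtype.ext
      change s(b, c) = Sym2.map φ s(φ.symm b, φ.symm c)
      simp
    exact this ▸ he

end Iteration

/-! ### Half-space geometry: far sets shrink to a point at infinity. -/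

section Geometry

variable {n : ℕ}

lemma height_pos (x : HalfSpace n) : 0 < height x := x.2

lemma hdist_self (x : HalfSpace n) : hdist x x = 0 := by simp [hdist]

lemma hdist_comm (x y : HalfSpace n) : hdist x y = hdist y x := by
  unfold hdist
  rw [norm_sub_rev, mul_comm (height x)]

lemma hdist_nonneg (x y : HalfSpace n) : 0 ≤ hdist x y :=
  mul_nonneg zero_le_two (Real.arsinh_nonneg_iff.2 (by positivity))

lemma sinh_half_hdist (x y : HalfSpace n) :
    Real.sinh (hdist x y / 2) = ‖x.1 - y.1‖ / (2 * √(height x * height y)) := by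
  rw [hdist, mul_div_cancel_left₀ _ two_ne_zero, Real.sinh_arsinh]

/-- Below height `1` the denominator in the distance formula is at most `2`, so hyperbolic bounds
give Euclidean ones. This is where low edges get bounded projection length. -/
lemma norm_sub_le_of_hdist_le {x y : HalfSpace n} {M : ℝ} (h : hdist x y ≤ M)
    (hx : height x ≤ 1) (hy : height y ≤ 1) : ‖x.1 - y.1‖ ≤ 2 * Real.sinh (M / 2) := by
  have hpos : 0 < height x * height y := mul_pos (height_pos x) (height_pos y)
  have h1 : √(height x * height y) ≤ 1 := by
    rw [Real.sqrt_le_one]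
    exact mul_le_one₀ hx (height_pos y).le hy
  have h2 : Real.sinh (hdist x y / 2) ≤ Real.sinh (M / 2) :=
    Real.sinh_le_sinh.2 (by linarith)
  have h3 : 0 ≤ Real.sinh (hdist x y / 2) :=
    Real.sinh_nonneg_iff.2 (by have := hdist_nonneg x y; linarith)
  have h4 : ‖x.1 - y.1‖ = Real.sinh (hdist x y / 2) * (2 * √(height x * height y)) := by
    rw [sinh_half_hdist, div_mul_cancel₀]
    have := Real.sqrt_pos.2 hpos
    positivity
  rw [h4]
  have h5 := Real.sqrt_nonneg (height x * height y)
  nlinarith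

lemma projDist_le (x y : HalfSpace n) : projDist x y ≤ ‖x.1 - y.1‖ := by
  refine (pi_norm_le_iff_of_nonneg (norm_nonneg _)).2 fun i => ?_
  exact PiLp.norm_apply_le (x.1 - y.1) i.castSucc

lemma projDist_triangle (x y z : HalfSpace n) : projDist x z ≤ projDist x y + projDist y z :=
  norm_sub_le_norm_sub_add_norm_sub _ _ _

/-- The Euclidean distance from `x` to the reflection of `z` in the boundary hyperplane. -/
noncomputable def reflDist (x z : HalfSpace n) : ℝ :=
  √(‖x.1 - z.1‖ ^ 2 + 4 * (height x * height z))

lemma norm_sub_le_reflDist (x z : HalfSpace n) : ‖x.1 - z.1‖ ≤ reflDist x z := by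
  refine Real.le_sqrt_of_sq_le ?_
  have := mul_pos (height_pos x) (height_pos z)
  linarith

lemma reflDist_pos (x z : HalfSpace n) : 0 < reflDist x z := by
  have := mul_pos (height_pos x) (height_pos z)
  exact Real.sqrt_pos.2 (by positivity)

lemma cosh_half_hdist (x y : HalfSpace n) :
    Real.cosh (hdist x y / 2) = reflDist x y / (2 * √(height x * height y)) := by
  have hpos := mul_pos (height_pos x) (height_pos y)
  have hs := Real.sqrt_pos.2 hpos
  have h1 : 0 ≤ reflDist x y / (2 * √(height x * height y)) :=
    div_nonneg (reflDist_pos x y).le (by positivity)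
  rw [← abs_of_nonneg h1, ← abs_of_pos (Real.cosh_pos _), ← sq_eq_sq_iff_abs_eq_abs,
    Real.cosh_sq, sinh_half_hdist, div_pow, div_pow, mul_pow, Real.sq_sqrt hpos.le, reflDist,
    Real.sq_sqrt (by positivity)]
  have hx := (height_pos x).ne'
  have hy := (height_pos y).ne'
  field_simp
  ring

/-- The Euclidean distance of `x` and `y` in a ball model with centre `z`. -/
noncomputable def chord (z x y : HalfSpace n) : ℝ :=
  Real.sinh (hdist x y / 2) / (Real.cosh (hdist x z / 2) * Real.cosh (hdist y z / 2))

/-- The heights of `x` and `y` cancel. Since `chord` is built from hyperbolic distances alone, this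
formula carries Euclidean estimates across an isometry. -/
lemma chord_eq (z x y : HalfSpace n) :
    chord z x y = 2 * height z * ‖x.1 - y.1‖ / (reflDist x z * reflDist y z) := by
  rw [chord, sinh_half_hdist, cosh_half_hdist, cosh_half_hdist,
    Real.sqrt_mul (height_pos x).le, Real.sqrt_mul (height_pos x).le,
    Real.sqrt_mul (height_pos y).le]
  have hx := Real.sqrt_pos.2 (height_pos x)
  have hy := Real.sqrt_pos.2 (height_pos y)
  have hz := Real.sqrt_pos.2 (height_pos z)
  have h1 := reflDist_pos x z
  have h2 := reflDist_pos y z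
  have hzz : height z = √(height z) ^ 2 := (Real.sq_sqrt (height_pos z).le).symm
  rw [hzz]
  simp only [Real.sqrt_sq hz.le]
  field_simp

lemma chord_map {Ψ : Equiv.Perm (HalfSpace n)} (hΨ : IsHIsometry Ψ) (z x y : HalfSpace n) :
    chord (Ψ z) (Ψ x) (Ψ y) = chord z x y := by
  simp only [chord, hΨ _ _]

/-- With `a` and `b` the reflected distances to `z`, both at least `k`, the chord is at most `2 (a +
b) / (a b) = 2 / a + 2 / b`. -/
lemma chord_le {z x y : HalfSpace n} (hz : height z ≤ 1) {k : ℝ} (hk : 0 < k)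
    (hx : k ≤ ‖x.1 - z.1‖) (hy : k ≤ ‖y.1 - z.1‖) : chord z x y ≤ 4 / k := by
  have hx' := hx.trans (norm_sub_le_reflDist x z)
  have hy' := hy.trans (norm_sub_le_reflDist y z)
  have h1 : ‖x.1 - y.1‖ ≤ reflDist x z + reflDist y z := by
    refine (norm_sub_le_norm_sub_add_norm_sub x.1 z.1 y.1).trans ?_
    rw [norm_sub_rev z.1 y.1]
    exact add_le_add (norm_sub_le_reflDist x z) (norm_sub_le_reflDist y z)
  rw [chord_eq, div_le_div_iff₀ (mul_pos (reflDist_pos x z) (reflDist_pos y z)) hk]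
  have hn := norm_nonneg (x.1 - y.1)
  have hp := height_pos z
  have h2 : height z * ‖x.1 - y.1‖ ≤ reflDist x z + reflDist y z := by nlinarith
  have hx0 := reflDist_pos x z
  have hy0 := reflDist_pos y z
  nlinarith [mul_le_mul_of_nonneg_right h2 hk.le, mul_le_mul_of_nonneg_left hx' hy0.le,
    mul_le_mul_of_nonneg_left hy' hx0.le]

lemma height_origin : height (origin n) = 1 := by
  simp [height, origin, axisPoint]

lemma reflDist_origin_le (x : HalfSpace n) :
    reflDist x (origin n) ≤ ‖x.1 - (origin n).1‖ + 2 := by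
  have hn := norm_nonneg (x.1 - (origin n).1)
  have h : height x - 1 ≤ ‖x.1 - (origin n).1‖ := by
    have h1 := PiLp.norm_apply_le (x.1 - (origin n).1) (Fin.last n)
    have h2 : (x.1 - (origin n).1) (Fin.last n) = height x - height (origin n) := rfl
    rw [h2, height_origin] at h1
    exact (le_abs_self _).trans h1
  refine Real.sqrt_le_iff.2 ⟨by positivity, ?_⟩
  rw [height_origin]
  nlinarith

/-- The points that `Ψ` maps to height at most `1` and to projection distance at least `k` from the
image of the origin. -/
def farSet (Ψ : Equiv.Perm (HalfSpace n)) (k : ℝ) : Set (HalfSpace n) :=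
  {x | height (Ψ x) ≤ 1 ∧ k ≤ projDist (Ψ (origin n)) (Ψ x)}

lemma le_norm_of_mem_farSet {Ψ : Equiv.Perm (HalfSpace n)} {k : ℝ} {x : HalfSpace n}
    (hx : x ∈ farSet Ψ k) : k ≤ ‖(Ψ x).1 - (Ψ (origin n)).1‖ := by
  rw [norm_sub_rev]
  exact hx.2.trans (projDist_le _ _)

/-- Seen from `Ψ (origin n)` the image of the far set has chords at most `4 / k`; by invariance so
does the far set seen from `o`. -/
lemma norm_sub_le_of_mem_farSet {Ψ : Equiv.Perm (HalfSpace n)} (hΨ : IsHIsometry Ψ)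
    (h1 : height (Ψ (origin n)) ≤ 1) {k : ℝ} (hk : 0 < k) {x y : HalfSpace n}
    (hx : x ∈ farSet Ψ k) (hy : y ∈ farSet Ψ k) :
    k * ‖x.1 - y.1‖ ≤ 2 * (‖x.1 - (origin n).1‖ + 2) * (‖y.1 - (origin n).1‖ + 2) := by
  have h := chord_le h1 hk (le_norm_of_mem_farSet hx) (le_norm_of_mem_farSet hy)
  rw [chord_map hΨ, chord_eq, height_origin,
    div_le_div_iff₀ (mul_pos (reflDist_pos _ _) (reflDist_pos _ _)) hk] at h
  have h2 := mul_le_mul (reflDist_origin_le x) (reflDist_origin_le y) (reflDist_pos _ _).le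
    (by positivity)
  nlinarith

/-- The invariant `cosh (hdist / 2)` is at least `k / 2` on the image side, where heights are at
most `1`. This keeps limits of far sets out of the half-space. -/
lemma height_le_of_mem_farSet {Ψ : Equiv.Perm (HalfSpace n)} (hΨ : IsHIsometry Ψ)
    (h1 : height (Ψ (origin n)) ≤ 1) {k : ℝ} (hk : 0 < k) {x : HalfSpace n}
    (hx : x ∈ farSet Ψ k) :
    k ^ 2 * height x ≤ (‖x.1 - (origin n).1‖ + 2) ^ 2 := by
  have h := cosh_half_hdist (Ψ x) (Ψ (origin n))
  rw [hΨ, cosh_half_hdist] at h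
  have hk' := (le_norm_of_mem_farSet hx).trans (norm_sub_le_reflDist _ _)
  have hr := reflDist_origin_le x
  have hr0 := reflDist_pos x (origin n)
  have hpx := height_pos x
  have hpo := height_pos (origin n)
  have hpx' := height_pos (Ψ x)
  have hpo' := height_pos (Ψ (origin n))
  have hs : √(height (Ψ x) * height (Ψ (origin n))) ≤ 1 := by
    rw [Real.sqrt_le_one]
    exact mul_le_one₀ hx.1 hpo'.le h1
  have hs0 : 0 < √(height (Ψ x) * height (Ψ (origin n))) := Real.sqrt_pos.2 (mul_pos hpx' hpo')
  have hx0 : 0 < √(height x) := Real.sqrt_pos.2 hpx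
  rw [height_origin, mul_one, div_eq_div_iff (by positivity) (by positivity)] at h
  have h2 : k * √(height x) ≤ reflDist x (origin n) := by
    nlinarith [mul_le_mul_of_nonneg_right hk' hx0.le, mul_le_mul_of_nonneg_left hs hr0.le]
  have h3 : (k * √(height x)) ^ 2 ≤ (‖x.1 - (origin n).1‖ + 2) ^ 2 :=
    pow_le_pow_left₀ (by positivity) (h2.trans hr) 2
  rwa [mul_pow, Real.sq_sqrt hpx.le] at h3

open Filter Topology in
/-- Far sets shrink, along a subsequence, to a point at infinity. -/
lemma exists_limit_of_farSet (Ψ : ℕ → Equiv.Perm (HalfSpace n)) (hΨ : ∀ k, IsHIsometry (Ψ k))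
    (h1 : ∀ k, height (Ψ k (origin n)) ≤ 1)
    (hne : ∀ k : ℕ, (farSet (Ψ k) (k + 1)).Nonempty) :
    ∃ ξ ∈ bdryAtInfty (Set.univ : Set (HalfSpace n)), ∃ φ : ℕ → ℕ, StrictMono φ ∧
      ∀ U ∈ 𝓝 ξ, ∀ᶠ j in atTop, ∀ x ∈ farSet (Ψ (φ j)) (φ j + 1), toCompact x ∈ U := by
  choose u hu using hne
  have hk : ∀ k : ℕ, (0 : ℝ) < k + 1 := fun k => by positivity
  have hmem : ∀ (ξ : OnePoint (E n)) (φ : ℕ → ℕ),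
      (∀ U ∈ 𝓝 ξ, ∀ᶠ j in atTop, ∀ x ∈ farSet (Ψ (φ j)) (φ j + 1), toCompact x ∈ U) →
      ξ ∈ closure (toCompact '' (Set.univ : Set (HalfSpace n))) := by
    intro ξ φ h
    rw [mem_closure_iff_nhds]
    intro U hU
    obtain ⟨j, hj⟩ := (h U hU).exists
    exact ⟨_, hj _ (hu (φ j)), _, trivial, rfl⟩
  -- Either some subsequence of the sample points `u k` converges in Euclidean space, or they escape
  -- to `∞`.
  by_cases hfreq : ∃ R : ℝ, ∃ᶠ k in atTop, ‖(u k).1 - (origin n).1‖ ≤ R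
  · obtain ⟨R, hR⟩ := hfreq
    have hR' : ∃ᶠ k in atTop, (u k).1 ∈ Metric.closedBall (origin n).1 R := by
      simpa [dist_eq_norm] using hR
    obtain ⟨x, hx, φ, hφ, hlim⟩ :=
      tendsto_subseq_of_frequently_bounded Metric.isBounded_closedBall hR'
    have hnorm : Tendsto (fun j => ‖(u (φ j)).1 - (origin n).1‖) atTop
        (𝓝 ‖x - (origin n).1‖) := (hlim.sub_const _).norm
    set A : ℝ := ‖x - (origin n).1‖ + 3
    have hA : 0 < A := by positivity
    have hbd : ∀ᶠ j in atTop, ‖(u (φ j)).1 - (origin n).1‖ + 2 < A := by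
      filter_upwards [hnorm.eventually (gt_mem_nhds (lt_add_one _))] with j hj
      simp only [A]; linarith
    have hcast : Tendsto (fun j => (φ j : ℝ) + 1) atTop atTop :=
      tendsto_atTop_add_const_right _ _ (tendsto_natCast_atTop_atTop.comp hφ.tendsto_atTop)
    have hU : ∀ U ∈ 𝓝 (x : OnePoint (E n)), ∀ᶠ j in atTop,
        ∀ y ∈ farSet (Ψ (φ j)) (φ j + 1), toCompact y ∈ U := by
      intro U hU
      have hU' : {z : E n | (z : OnePoint (E n)) ∈ U} ∈ 𝓝 x :=
        OnePoint.continuous_coe.continuousAt.preimage_mem_nhds hU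
      obtain ⟨ε, hε, hball⟩ := Metric.mem_nhds_iff.1 hU'
      have hclose : ∀ᶠ j in atTop, dist (u (φ j)).1 x < ε / 2 :=
        (Metric.tendsto_nhds.1 hlim) _ (by positivity)
      -- For `t = ‖u - y‖`, the far-set bound reads `(k + 1) t ≤ 2 A t + 2 A ^ 2`. The threshold
      -- makes this fail once `t ≥ ε / 2`.
      filter_upwards [hclose, hbd, hcast.eventually_gt_atTop (2 * A + 4 * A ^ 2 / ε)]
        with j hj hb hkj y hy
      apply hball
      rw [Metric.mem_ball]
      have h2 := norm_sub_le_of_mem_farSet (hΨ _) (h1 _) (hk (φ j)) (hu (φ j)) hy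
      have h3 : ‖y.1 - (origin n).1‖ ≤ ‖(u (φ j)).1 - y.1‖ + ‖(u (φ j)).1 - (origin n).1‖ := by
        rw [norm_sub_rev _ y.1]
        exact norm_sub_le_norm_sub_add_norm_sub _ _ _
      have h4 := norm_nonneg ((u (φ j)).1 - y.1)
      have h5 : ((φ j : ℝ) + 1) * ‖(u (φ j)).1 - y.1‖ ≤ 2 * A * (‖(u (φ j)).1 - y.1‖ + A) := by
        refine h2.trans ?_
        have : 0 ≤ ‖(u (φ j)).1 - (origin n).1‖ := norm_nonneg _
        refine mul_le_mul (by linarith) (by linarith) (by positivity) (by positivity)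
      have h6 : ‖(u (φ j)).1 - y.1‖ < ε / 2 := by
        by_contra hcon
        rw [not_lt] at hcon
        have h7 : (4 * A ^ 2 / ε) * (ε / 2) = 2 * A ^ 2 := by field_simp; ring
        have h8 : (2 * A + 4 * A ^ 2 / ε) * ‖(u (φ j)).1 - y.1‖ <
            ((φ j : ℝ) + 1) * ‖(u (φ j)).1 - y.1‖ :=
          mul_lt_mul_of_pos_right hkj (by linarith)
        have h9 : (4 * A ^ 2 / ε) * (ε / 2) ≤ (4 * A ^ 2 / ε) * ‖(u (φ j)).1 - y.1‖ :=
          mul_le_mul_of_nonneg_left hcon (by positivity)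
        nlinarith
      calc dist y.1 x ≤ dist y.1 (u (φ j)).1 + dist (u (φ j)).1 x := dist_triangle _ _ _
        _ < ε / 2 + ε / 2 := by
          rw [dist_comm y.1, dist_eq_norm (u (φ j)).1 y.1]
          linarith
        _ = ε := by ring
    refine ⟨x, ⟨hmem _ φ hU, ?_⟩, φ, hφ, hU⟩
    -- A limit inside the half-space would keep the heights of `u` bounded below, while far points
    -- at bounded distance have height `O(k⁻²)`.
    rintro ⟨y, hy⟩
    have hyx : y.1 = x := OnePoint.coe_injective hy
    have hheight : Tendsto (fun j => height (u (φ j))) atTop (𝓝 (height y)) := by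
      have hc : Continuous fun z : E n => z (Fin.last n) := by fun_prop
      have := (hc.tendsto x).comp hlim
      rw [← hyx] at this
      exact this
    have hsq : Tendsto (fun j => ((φ j : ℝ) + 1) ^ 2) atTop atTop :=
      (tendsto_pow_atTop two_ne_zero).comp hcast
    have hev := hheight.eventually (lt_mem_nhds (half_lt_self (height_pos y)))
    obtain ⟨j, hj1, hj2, hj3⟩ := (hev.and (hbd.and
      (hsq.eventually_gt_atTop (2 * A ^ 2 / height y)))).exists
    have h2 := height_le_of_mem_farSet (hΨ _) (h1 _) (hk (φ j)) (hu (φ j))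
    have h3 : (‖(u (φ j)).1 - (origin n).1‖ + 2) ^ 2 ≤ A ^ 2 :=
      pow_le_pow_left₀ (by positivity) hj2.le 2
    have h4 : (2 * A ^ 2 / height y) * (height y / 2) = A ^ 2 := by
      have := (height_pos y).ne'
      field_simp
    have h5 : (2 * A ^ 2 / height y) * (height y / 2) <
        ((φ j : ℝ) + 1) ^ 2 * height (u (φ j)) :=
      mul_lt_mul hj3 hj1.le (half_pos (height_pos y)) (by positivity)
    linarith
  · push Not at hfreq
    have hU : ∀ U ∈ 𝓝 (OnePoint.infty : OnePoint (E n)), ∀ᶠ j in atTop,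
        ∀ y ∈ farSet (Ψ (id j)) ((id j : ℕ) + 1), toCompact y ∈ U := by
      intro U hU
      have hU' : {z : E n | (z : OnePoint (E n)) ∈ U} ∈ cocompact (E n) := by
        have := OnePoint.comap_coe_nhds_infty (X := E n) ▸ preimage_mem_comap hU
        rwa [coclosedCompact_eq_cocompact] at this
      obtain ⟨R, hR⟩ := Metric.closedBall_compl_subset_of_mem_cocompact hU' (origin n).1
      set B : ℝ := |R| + 2
      have hB : 0 < B := by positivity
      -- A far point `y` in the ball would have `t = ‖u - y‖ ≥ 1`, hence `(k + 1) t ≤ 2 B t + 2 B ^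
      -- 2 ≤ (2 B + 2 B ^ 2) t`, contradicting the threshold.
      filter_upwards [hfreq (|R| + 1), tendsto_natCast_atTop_atTop.eventually_gt_atTop
        (2 * B + 2 * B ^ 2)] with k hk1 hk2 y hy
      apply hR
      rw [Set.mem_compl_iff, Metric.mem_closedBall, dist_eq_norm]
      intro hcon
      have hb : ‖y.1 - (origin n).1‖ + 2 ≤ B := by
        have := le_abs_self R
        simp only [B]; linarith
      have h2 := norm_sub_le_of_mem_farSet (hΨ _) (h1 _) (hk k) (hu k) hy
      have h3 : ‖(u k).1 - (origin n).1‖ ≤ ‖(u k).1 - y.1‖ + ‖y.1 - (origin n).1‖ :=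
        norm_sub_le_norm_sub_add_norm_sub _ _ _
      have h4 : 1 ≤ ‖(u k).1 - y.1‖ := by
        have := le_abs_self R
        linarith
      have h5 : ((k : ℝ) + 1) * ‖(u k).1 - y.1‖ ≤ 2 * (‖(u k).1 - y.1‖ + B) * B := by
        refine h2.trans ?_
        have : 0 ≤ ‖y.1 - (origin n).1‖ := norm_nonneg _
        refine mul_le_mul (by linarith) hb (by positivity) (by positivity)
      nlinarith
    exact ⟨OnePoint.infty, ⟨hmem _ id hU, fun ⟨y, hy⟩ => OnePoint.coe_ne_infty _ hy⟩, id,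
      strictMono_id, hU⟩

end Geometry

/-! ### Invariance of Bernoulli percolation under relabelling of edges. -/

section Bernoulli

variable {ι : Type*}

lemma dependsOn_image (σ : ι ≃ ι) {P : Set ι → Prop} {F : Finset ι} (hP : DependsOn P F) :
    DependsOn (fun ω => P (σ '' ω)) (F.map σ.symm.toEmbedding) := by
  intro ω
  have h : σ '' (ω ∩ (F.map σ.symm.toEmbedding : Finset ι)) = σ '' ω ∩ F := by
    rw [Set.image_inter σ.injective, Finset.coe_map, Equiv.coe_toEmbedding,
      Equiv.image_symm_image]
  change P (σ '' ω) ↔ P (σ '' (ω ∩ _))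
  rw [h]
  exact hP _

lemma prob_image (σ : ι ≃ ι) (p : ℝ) (F : Finset ι) (P : Set ι → Prop) :
    prob p (F.map σ.symm.toEmbedding) (fun ω => P (σ '' ω)) = prob p F P := by
  rw [prob, expect_map]
  simp only [Equiv.image_symm_image, prob]

end Bernoulli

/-! ### Uniform smallness at parameters of the null set. -/

variable {n : ℕ} {V : Set (HalfSpace n)} {G : SimpleGraph V}

instance (p : unitInterval) : IsProbabilityMeasure (percLaw G p) := by
  unfold percLaw; infer_instance

lemma reachable_of_conn {ω : Set G.edgeSet} {S : Set V} {a b : V} (h : Conn ω S a b) :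
    (openGraph ω).Reachable a b := by
  induction h with
  | refl => exact SimpleGraph.Reachable.refl _
  | @tail b c _ hbc ih =>
    obtain ⟨_, _, hadj, he⟩ := hbc
    refine ih.trans (SimpleGraph.Adj.reachable ?_)
    exact (SimpleGraph.fromEdgeSet_adj _).2 ⟨⟨_, he, rfl⟩, hadj.ne⟩

open Filter Topology in
/-- At a parameter in the null set, the probability of reaching projection distance `k` below
height `1` is small for large `k`, uniformly over all positions of the graph. -/
lemma exists_uniform_small (hG : IsGeodesicTransitiveGraph G) (ho : origin n ∈ V)
    {q : unitInterval} (hq : q ∈ nullSet G ho) {ε : ℝ} (hε : 0 < ε) :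
    ∃ k : ℕ, ∀ Φ : Equiv.Perm (HalfSpace n), IsHIsometry Φ → ∀ v : V, ∀ W : Finset V, v ∈ W →
      (∀ u ∈ W, height (Φ u) ≤ 1) →
      prob q (edgesIn G W) (JoinedIn W v {u | (k : ℝ) + 1 ≤ projDist (Φ v) (Φ u)}) < ε := by
  by_contra hcon
  push Not at hcon
  choose Φ hΦ v W hvW hW hprob using hcon
  obtain ⟨Γ, hΓ, htrans⟩ := hG.transitive
  choose γ hγ hγo using fun k => htrans ⟨origin n, ho⟩ (v k)
  choose hγi φ hφ using fun k => hΓ (γ k) (hγ k)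
  -- Precomposing with `γ k` moves the starting vertex `v k` to `o`, so that all bad events concern
  -- the cluster of `o`.
  set Ψ : ℕ → Equiv.Perm (HalfSpace n) := fun k => (γ k).trans (Φ k)
  have hΨ : ∀ k, IsHIsometry (Ψ k) := fun k x y => by
    simp only [Ψ, Equiv.trans_apply]
    rw [hΦ, hγi]
  have hΨo : ∀ k, Ψ k (origin n) = Φ k (v k) := fun k => by
    simp only [Ψ, Equiv.trans_apply]
    rw [← hγo k]
  have h1 : ∀ k, height (Ψ k (origin n)) ≤ 1 := fun k => by
    rw [hΨo]; exact hW k _ (hvW k)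
  set B : ℕ → Set (Set G.edgeSet) := fun k =>
    {ω | JoinedIn (W k : Set V) (v k) {u | (k : ℝ) + 1 ≤ projDist (Φ k (v k)) (Φ k u)}
      ((φ k).mapEdgeSet '' ω)}
  have hdep := fun k => measurableSet_of_dependsOn (dependsOn_image (φ k).mapEdgeSet
    (dependsOn_joinedIn (G := G) (W k) (v k) {u | (k : ℝ) + 1 ≤ projDist (Φ k (v k)) (Φ k u)}))
  have hBm : ∀ k, MeasurableSet (B k) := fun k => (hdep k).1
  have hBp : ∀ k, ε ≤ (percLaw G q).real (B k) := fun k => by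
    have := (hdep k).2 q
    rw [prob_image] at this
    exact (hprob k).trans this.ge
  have hBfar : ∀ k, ∀ ω ∈ B k, ∃ u : V, (openGraph ω).Reachable ⟨origin n, ho⟩ u ∧
      (u : HalfSpace n) ∈ farSet (Ψ k) (k + 1) := by
    rintro k ω ⟨u, hu, hc⟩
    have hφo : (φ k).symm (v k) = ⟨origin n, ho⟩ := by
      rw [RelIso.symm_apply_eq]
      exact Subtype.ext ((hγo k).symm.trans (hφ k _).symm)
    have hγu : γ k ((φ k).symm u : V) = u := by
      rw [← hφ k, RelIso.apply_symm_apply]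
    refine ⟨(φ k).symm u, hφo ▸ reachable_of_conn (conn_of_conn_image (φ k) hc), ?_, ?_⟩
    · simp only [Ψ, Equiv.trans_apply, hγu]
      exact hW k _ (hc.mem (hvW k))
    · rw [hΨo]
      simp only [Ψ, Equiv.trans_apply, hγu]
      exact hu
  have hne : ∀ k : ℕ, (farSet (Ψ k) (k + 1)).Nonempty := fun k => by
    have : (B k).Nonempty := by
      by_contra h
      rw [Set.not_nonempty_iff_eq_empty] at h
      have := hBp k
      rw [h, measureReal_empty] at this
      linarith
    obtain ⟨ω, hω⟩ := this
    obtain ⟨u, _, hu⟩ := hBfar k ω hω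
    exact ⟨u, hu⟩
  obtain ⟨ξ, hξ, θ, hθ, hU⟩ := exists_limit_of_farSet Ψ hΨ h1 hne
  -- The intersection of the sets `A m` is the limsup of the bad events along the subsequence;
  -- continuity from above gives it probability at least `ε`.
  set A : ℕ → Set (Set G.edgeSet) := fun m => ⋃ j : {j // m ≤ j}, B (θ j)
  have hAanti : Antitone A := by
    intro m m' hm
    refine Set.iUnion_subset fun j => ?_
    exact Set.subset_iUnion (fun j : {j // m ≤ j} => B (θ j)) ⟨j.1, hm.trans j.2⟩
  have hAm : ∀ m, MeasurableSet (A m) := fun m => MeasurableSet.iUnion fun j => hBm _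
  have hAp : ∀ m, ENNReal.ofReal ε ≤ percLaw G q (A m) := fun m => by
    refine le_trans ?_ (measure_mono
      (Set.subset_iUnion (fun j : {j // m ≤ j} => B (θ j)) ⟨m, le_rfl⟩))
    rw [ENNReal.ofReal_le_iff_le_toReal (measure_ne_top _ _)]
    exact hBp _
  have hinter : ENNReal.ofReal ε ≤ percLaw G q (⋂ m, A m) := by
    rw [hAanti.measure_iInter (fun m => (hAm m).nullMeasurableSet) ⟨0, measure_ne_top _ _⟩]
    exact le_iInf hAp
  have hsub : (⋂ m, A m) ⊆ {ω | ξ ∈ bdryAtInfty (cluster ω ⟨origin n, ho⟩)} := by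
    intro ω hω
    refine ⟨mem_closure_iff_nhds.2 fun U hUξ => ?_, hξ.2⟩
    obtain ⟨m, hm⟩ := eventually_atTop.1 (hU U hUξ)
    obtain ⟨⟨j, hj⟩, hωj⟩ := Set.mem_iUnion.1 (Set.mem_iInter.1 hω m)
    obtain ⟨u, hr, hu⟩ := hBfar _ ω hωj
    exact ⟨_, hm j hj _ hu, _, ⟨u, hr, Or.inl rfl⟩, rfl⟩
  -- Nullity passes to subsets, so measurability of the event for `ξ` is not needed.
  have hzero := measure_mono_null hsub (hq ξ hξ)
  rw [hzero] at hinter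
  have := ENNReal.ofReal_pos.2 hε
  exact absurd hinter (not_le.2 this)

/-! ### From paths of the clipped graph to open paths of low vertices. -/

lemma left_mem_hseg (x y : HalfSpace n) : x ∈ hseg x y := by
  simp [hseg, hdist_self]

lemma right_mem_hseg (x y : HalfSpace n) : y ∈ hseg x y := by
  simp [hseg, hdist_self]

lemma hseg_comm (x y : HalfSpace n) : hseg x y = hseg y x := by
  ext z
  simp only [hseg, Set.mem_ofPred_eq]
  rw [hdist_comm x z, hdist_comm z y, hdist_comm x y, add_comm]

lemma edgeSeg_mk (u v : V) : edgeSeg s(u, v) = hseg (u : HalfSpace n) v := by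
  ext z
  constructor
  · rintro ⟨a, b, hab, hz⟩
    rcases Sym2.eq_iff.1 hab with ⟨rfl, rfl⟩ | ⟨rfl, rfl⟩
    · exact hz
    · rwa [hseg_comm]
  · exact fun hz => ⟨u, v, rfl, hz⟩

lemma mem_edgeSeg_of_mem {e : Sym2 V} {u : V} (hu : u ∈ e) : (u : HalfSpace n) ∈ edgeSeg e := by
  obtain ⟨w, rfl⟩ := hu
  rw [edgeSeg_mk]
  exact left_mem_hseg _ _

/-- A vertex on an edge is one of its endpoints. -/
lemma mem_of_mem_edgeSeg (hG : IsGeodesicTransitiveGraph G) (e : G.edgeSet) {w : V}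
    (hw : (w : HalfSpace n) ∈ edgeSeg (e : Sym2 V)) : w ∈ (e : Sym2 V) := by
  obtain ⟨e, he⟩ := e
  induction e with
  | _ u v =>
    rw [edgeSeg_mk] at hw
    exact Sym2.mem_iff.2 (hG.vertex_on_edge u v w he hw)

lemma finite_incident_edges (hG : IsGeodesicTransitiveGraph G) (o : V) :
    {e : G.edgeSet | o ∈ (e : Sym2 V)}.Finite := by
  have h := hG.finite_edges {(o : HalfSpace n)} isCompact_singleton
  refine Set.Finite.of_finite_image (f := Subtype.val) (h.subset ?_)
    Subtype.val_injective.injOn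
  rintro _ ⟨e, he, rfl⟩
  exact ⟨e.2, o, mem_edgeSeg_of_mem he, rfl⟩

/-- The lengths of the edges are bounded. -/
lemma exists_hdist_le (hG : IsGeodesicTransitiveGraph G) (ho : origin n ∈ V) :
    ∃ M : ℝ, 0 ≤ M ∧ ∀ u v : V, G.Adj u v → hdist (u : HalfSpace n) v ≤ M := by
  have hfin : {v : V | G.Adj ⟨origin n, ho⟩ v}.Finite := by
    have h := (finite_incident_edges hG ⟨origin n, ho⟩).image Subtype.val
    refine Set.Finite.of_finite_image (f := fun v => s((⟨origin n, ho⟩ : V), v)) (h.subset ?_) ?_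
    · rintro _ ⟨v, hv, rfl⟩
      exact ⟨⟨s(⟨origin n, ho⟩, v), G.mem_edgeSet.2 hv⟩, Sym2.mem_mk_left _ _, rfl⟩
    · intro a _ b _ hab
      exact Sym2.congr_right.1 hab
  obtain ⟨M, hM⟩ := (hfin.image fun v : V => hdist (origin n) v).bddAbove
  refine ⟨max M 0, le_max_right _ _, fun u v huv => ?_⟩
  obtain ⟨Γ, hΓ, htrans⟩ := hG.transitive
  obtain ⟨γ, hγ, hγu⟩ := htrans u ⟨origin n, ho⟩
  obtain ⟨hiso, φ, hφ⟩ := hΓ γ hγ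
  rw [← hiso, hγu, ← hφ v]
  refine le_trans (hM ⟨φ v, ?_, rfl⟩) (le_max_left _ _)
  have : φ u = ⟨origin n, ho⟩ := Subtype.ext ((hφ u).trans hγu)
  rw [Set.mem_ofPred_eq, ← this]
  exact φ.map_adj_iff.2 huv

/-- A compact exhaustion and local finiteness. Countability is what allows passing from finite
vertex sets to their union in `percLaw_joinedIn_le`. -/
lemma countable_vertices (hG : IsGeodesicTransitiveGraph G) : Countable V := by
  have hopen : IsOpen {x : E n | 0 < x (Fin.last n)} :=
    isOpen_lt continuous_const (by fun_prop)
  have : LocallyCompactSpace (HalfSpace n) := hopen.locallyCompactSpace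
  have : V = ⋃ k, V ∩ compactCovering (HalfSpace n) k := by
    rw [← Set.inter_iUnion, iUnion_compactCovering, Set.inter_univ]
  refine Set.Countable.to_subtype ?_
  rw [this]
  exact Set.countable_iUnion fun k =>
    (hG.finite_vertices _ (isCompact_compactCovering _ k)).countable

/-- Both endpoints of an edge of the clipped graph, and the edge itself, lie on one open edge. -/
lemma exists_of_clippedGraph_adj {ω : Set G.edgeSet} {Φ : Equiv.Perm (HalfSpace n)}
    {A : Set (HalfSpace n)} {x y : HalfSpace n} (h : (clippedGraph ω Φ A).Adj x y) :
    ∃ e ∈ ω, x ∈ Φ '' edgeSeg (e : Sym2 V) ∩ A ∧ hseg x y ⊆ Φ '' edgeSeg (e : Sym2 V) ∩ A := by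
  obtain ⟨_, ⟨e, he, heq⟩ | ⟨e, he, heq⟩⟩ := (SimpleGraph.fromRel_adj _ _ _).1 h
  · have hs : hseg x y ⊆ Φ '' edgeSeg (e : Sym2 V) ∩ A := heq ▸ connectedComponentIn_subset _ _
    exact ⟨e, he, hs (left_mem_hseg _ _), hs⟩
  · have hs : hseg x y ⊆ Φ '' edgeSeg (e : Sym2 V) ∩ A := by
      rw [hseg_comm]; exact heq ▸ connectedComponentIn_subset _ _
    exact ⟨e, he, hs (left_mem_hseg _ _), hs⟩

/-- The vertices below height `1`. -/
def lowVertices (V : Set (HalfSpace n)) (Φ : Equiv.Perm (HalfSpace n)) : Set V :=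
  {u | height (Φ u) ≤ 1}

/-- The point `x` lies on an open edge at a vertex joined to `o` by an open path in `L`. -/
def NearPath (ω : Set G.edgeSet) (Φ : Equiv.Perm (HalfSpace n)) (o : V) (x : HalfSpace n) : Prop :=
  ∃ u : V, Conn ω (lowVertices V Φ) o u ∧ (x = Φ u ∨
    ∃ e ∈ ω, u ∈ (e : Sym2 V) ∧ x ∈ Φ '' edgeSeg (e : Sym2 V))

lemma conn_of_mem_edge {ω : Set G.edgeSet} {L : Set V} {e : G.edgeSet} (he : e ∈ ω) {u w : V}
    (hu : u ∈ (e : Sym2 V)) (hw : w ∈ (e : Sym2 V)) (huL : u ∈ L) (hwL : w ∈ L) :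
    Conn ω L u w := by
  by_cases huw : u = w
  · rw [huw]; exact Relation.ReflTransGen.refl
  · have heq : (e : Sym2 V) = s(u, w) := (Sym2.mem_and_mem_iff huw).1 ⟨hu, hw⟩
    have hadj : G.Adj u w := by
      rw [← G.mem_edgeSet, ← heq]; exact e.2
    refine Relation.ReflTransGen.single ⟨huL, hwL, hadj, ?_⟩
    have : e = ⟨s(u, w), G.mem_edgeSet.2 hadj⟩ := Subtype.ext heq
    exact this ▸ he

/-- Distinct edges meet only at a common endpoint. A change of edge at `x` thus happens at a vertex,
which is low because `x` is, and the vertex path extends to it along the old edge. -/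
lemma NearPath.of_mem (hG : IsGeodesicTransitiveGraph G) {ω : Set G.edgeSet}
    {Φ : Equiv.Perm (HalfSpace n)} {o : V} (ho : o ∈ lowVertices V Φ) {x y : HalfSpace n}
    (h : NearPath ω Φ o x) {e : G.edgeSet} (he : e ∈ ω)
    (hx : x ∈ Φ '' edgeSeg (e : Sym2 V)) (hxL : height x ≤ 1)
    (hy : y ∈ Φ '' edgeSeg (e : Sym2 V)) : NearPath ω Φ o y := by
  obtain ⟨u, hu, rfl | ⟨e', he', hue', z, hz, rfl⟩⟩ := h
  · obtain ⟨z, hz, hzu⟩ := hx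
    rw [Φ.injective hzu] at hz
    exact ⟨u, hu, Or.inr ⟨e, he, mem_of_mem_edgeSeg hG e hz, hy⟩⟩
  · by_cases hee : e = e'
    · subst hee
      exact ⟨u, hu, Or.inr ⟨e, he, hue', hy⟩⟩
    · have hz' : z ∈ edgeSeg (e : Sym2 V) := by
        obtain ⟨z', hz', h⟩ := hx
        rwa [Φ.injective h] at hz'
      obtain ⟨w, rfl, hwe, hwe'⟩ := hG.edge_inter e e.2 e' e'.2
        (fun h => hee (Subtype.ext h)) z ⟨hz', hz⟩
      have hc := conn_of_mem_edge he' hue' hwe' (hu.mem ho) hxL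
      exact ⟨w, hu.trans hc, Or.inr ⟨e, he, hwe, hy⟩⟩

/-- An open path of the clipped graph stays near an open path of vertices below height `1`. -/
lemma exists_nearPath_of_joinsTo (hG : IsGeodesicTransitiveGraph G) {ω : Set G.edgeSet}
    {Φ : Equiv.Perm (HalfSpace n)} {o : V} (ho : o ∈ lowVertices V Φ) {S : Set (HalfSpace n)}
    (h : JoinsTo (clippedGraph ω Φ (lowerRegion n 1)) (Φ o) S) :
    ∃ s ∈ S, NearPath ω Φ o s ∧ height s ≤ 1 := by
  have hreach : ∀ y, (clippedGraph ω Φ (lowerRegion n 1)).Reachable (Φ o) y →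
      NearPath ω Φ o y ∧ height y ≤ 1 := by
    intro y hy
    rw [SimpleGraph.reachable_iff_reflTransGen] at hy
    induction hy with
    | refl => exact ⟨⟨o, Relation.ReflTransGen.refl, Or.inl rfl⟩, ho⟩
    | @tail b c _ hbc ih =>
      obtain ⟨e, he, hb, hs⟩ := exists_of_clippedGraph_adj hbc
      have hc := hs (right_mem_hseg _ _)
      exact ⟨ih.1.of_mem hG ho he hb.1 ih.2 hc.1, hc.2⟩
  obtain ⟨y, hy, hyS | ⟨z, hyz, s, hs, hsS⟩⟩ := h
  · exact ⟨y, hyS, hreach y hy⟩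
  · obtain ⟨e, he, hb, hsub⟩ := exists_of_clippedGraph_adj hyz
    exact ⟨s, hsS, (hreach y hy).1.of_mem hG ho he hb.1 (hreach y hy).2 (hsub hs).1, (hsub hs).2⟩

lemma continuous_projDist (x : HalfSpace n) : Continuous (projDist x) := by
  unfold projDist proj
  fun_prop

lemma le_projDist_of_mem_sphereS {r : ℝ} {s : HalfSpace n} (hs : s ∈ sphereS n r) :
    r ≤ projDist (origin n) s := by
  by_contra h
  rw [not_le] at h
  have hopen : IsOpen {y : HalfSpace n | projDist (origin n) y < r} :=
    isOpen_lt (continuous_projDist _) continuous_const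
  have : s ∈ interior (ballB n r) :=
    interior_maximal (fun y (hy : projDist (origin n) y < r) => hy.le) hopen h
  exact hs.2 this

/-- This allows `S_r`, which is centred at `o`, to be measured from `Φ (origin n)`. -/
lemma proj_eq_of_isPhi {h : ℝ} {R : E n ≃ₗᵢ[ℝ] E n} {Φ : Equiv.Perm (HalfSpace n)}
    (hΦ : IsPhi h R Φ) : proj (Φ (origin n)) = proj (origin n) := by
  funext i
  have : i.castSucc ≠ Fin.last n := (Fin.castSucc_lt_last i).ne
  rw [proj, hΦ.map_origin]
  simp [proj, origin, axisPoint, this]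

lemma height_of_isPhi {h : ℝ} {R : E n ≃ₗᵢ[ℝ] E n} {Φ : Equiv.Perm (HalfSpace n)}
    (hΦ : IsPhi h R Φ) : height (Φ (origin n)) = h := by
  simp [height, hΦ.map_origin]

/-- An endpoint of an edge is close to every point of the edge below height `1`. -/
lemma projDist_le_of_mem_edge {M : ℝ} (hM : ∀ u v : V, G.Adj u v → hdist (u : HalfSpace n) v ≤ M)
    {Φ : Equiv.Perm (HalfSpace n)} (hΦ : IsHIsometry Φ) {e : G.edgeSet} {u : V}
    (hu : u ∈ (e : Sym2 V)) (huL : height (Φ u) ≤ 1) {s : HalfSpace n}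
    (hs : s ∈ Φ '' edgeSeg (e : Sym2 V)) (hsL : height s ≤ 1) :
    projDist (Φ u) s ≤ 2 * Real.sinh (M / 2) := by
  obtain ⟨e, he⟩ := e
  obtain ⟨w, hw⟩ := hu
  simp only at hw
  subst hw
  obtain ⟨z, hz, rfl⟩ := hs
  simp only [edgeSeg_mk] at hz
  refine (projDist_le _ _).trans (norm_sub_le_of_hdist_le ?_ huL hsL)
  rw [hΦ]
  have h1 : hdist (u : HalfSpace n) z + hdist z w = hdist (u : HalfSpace n) w := hz
  have h2 := hdist_nonneg z (w : HalfSpace n)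
  have h3 := hM u w he
  linarith

/-- The event in the definition of `gFun` forces a long open path of vertices below height `1`. -/
lemma exists_joinedIn_of_joinsTo (hG : IsGeodesicTransitiveGraph G) (ho : origin n ∈ V) {M : ℝ}
    (hM0 : 0 ≤ M) (hM : ∀ u v : V, G.Adj u v → hdist (u : HalfSpace n) v ≤ M)
    {h r : ℝ} {R : E n ≃ₗᵢ[ℝ] E n}
    {Φ : Equiv.Perm (HalfSpace n)} (hΦ : IsPhi h R Φ) (hh : h ≤ 1) {ω : Set G.edgeSet}
    (hj : JoinsTo (clippedGraph ω Φ (lowerRegion n 1)) (Φ (origin n)) (sphereS n r)) :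
    JoinedIn (lowVertices V Φ) ⟨origin n, ho⟩
      {u | r - 2 * Real.sinh (M / 2) ≤ projDist (Φ (origin n)) (Φ u)} ω := by
  have hoL : (⟨origin n, ho⟩ : V) ∈ lowVertices V Φ := (height_of_isPhi hΦ).trans_le hh
  obtain ⟨s, hs, ⟨u, hu, hsu⟩, hsL⟩ :=
    exists_nearPath_of_joinsTo (o := ⟨origin n, ho⟩) hG hoL hj
  have hr := le_projDist_of_mem_sphereS hs
  have hK : 0 ≤ 2 * Real.sinh (M / 2) :=
    mul_nonneg zero_le_two (Real.sinh_nonneg_iff.2 (by linarith))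
  refine ⟨u, ?_, hu⟩
  have heq : projDist (origin n) s = projDist (Φ (origin n)) s := by
    rw [projDist, projDist, proj_eq_of_isPhi hΦ]
  rw [heq] at hr
  rw [Set.mem_ofPred_eq]
  rcases hsu with rfl | ⟨e, he, hue, hse⟩
  · linarith
  · have h1 := projDist_le_of_mem_edge hM hΦ.isometry hue (hu.mem hoL) hse hsL
    have h2 := projDist_triangle (Φ (origin n)) (Φ u) s
    linarith

/-- If all edges at `o` are closed, then no open path from `o` reaches positive distance. -/
lemma not_joinsTo_of_isolated (hG : IsGeodesicTransitiveGraph G) (ho : origin n ∈ V)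
    {h r : ℝ} (hr : 0 < r) {R : E n ≃ₗᵢ[ℝ] E n}
    {Φ : Equiv.Perm (HalfSpace n)} (hΦ : IsPhi h R Φ) {ω : Set G.edgeSet} {A : Set (HalfSpace n)}
    (hω : ∀ e ∈ ω, (⟨origin n, ho⟩ : V) ∉ (e : Sym2 V)) :
    ¬JoinsTo (clippedGraph ω Φ A) (Φ (origin n)) (sphereS n r) := by
  have hadj : ∀ z, ¬(clippedGraph ω Φ A).Adj (Φ (origin n)) z := by
    intro z hz
    obtain ⟨e, he, ⟨⟨x, hx, hxo⟩, _⟩, _⟩ := exists_of_clippedGraph_adj hz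
    rw [Φ.injective hxo] at hx
    exact hω e he (mem_of_mem_edgeSeg hG (w := ⟨origin n, ho⟩) e hx)
  rintro ⟨y, hy, hyS⟩
  have hyo : y = Φ (origin n) := by
    rw [SimpleGraph.reachable_iff_reflTransGen] at hy
    rcases Relation.ReflTransGen.cases_head hy with h | ⟨c, hc, _⟩
    · exact h.symm
    · exact absurd hc (hadj _)
  subst hyo
  rcases hyS with hyS | ⟨z, hz, _⟩
  · have := le_projDist_of_mem_sphereS hyS
    rw [projDist, proj_eq_of_isPhi hΦ, sub_self, norm_zero] at this
    linarith
  · exact hadj z hz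

/-! ### Exponential decay below the threshold. -/

variable {n : ℕ} {V : Set (HalfSpace n)} {G : SimpleGraph V}

/-- Connection probabilities in an infinite set of vertices are limits of those in finite sets. -/
lemma percLaw_joinedIn_le [Countable V] (p : unitInterval) {L : Set V} {o : V} (ho : o ∈ L)
    {T : Set V} {b : ℝ}
    (h : ∀ W : Finset V, (W : Set V) ⊆ L → o ∈ W → prob p (edgesIn G W) (JoinedIn W o T) ≤ b) :
    percLaw G p {ω | JoinedIn L o T ω} ≤ ENNReal.ofReal b := by
  classical
  have hsub : {ω : Set G.edgeSet | JoinedIn L o T ω} ⊆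
      ⋃ W : {W : Finset V // (W : Set V) ⊆ L ∧ o ∈ W}, {ω | JoinedIn (W.1 : Set V) o T ω} := by
    rintro ω ⟨t, ht, hc⟩
    obtain ⟨W, hW, hoW, hc'⟩ := exists_finset_conn ho hc
    exact Set.mem_iUnion.2 ⟨⟨W, hW, hoW⟩, t, ht, hc'⟩
  have hdir : Directed (· ⊆ ·) fun W : {W : Finset V // (W : Set V) ⊆ L ∧ o ∈ W} =>
      {ω : Set G.edgeSet | JoinedIn (W.1 : Set V) o T ω} := by
    intro W W'
    refine ⟨⟨W.1 ∪ W'.1, ?_, Finset.mem_union_left _ W.2.2⟩, ?_, ?_⟩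
    · rw [Finset.coe_union]
      exact Set.union_subset W.2.1 W'.2.1
    · exact fun ω => JoinedIn.mono (Finset.coe_subset.2 Finset.subset_union_left) subset_rfl
        subset_rfl
    · exact fun ω => JoinedIn.mono (Finset.coe_subset.2 Finset.subset_union_right) subset_rfl
        subset_rfl
  refine (measure_mono hsub).trans ?_
  rw [hdir.measure_iUnion]
  refine iSup_le fun W => ?_
  have h1 := (measurableSet_of_dependsOn (dependsOn_joinedIn (G := G) W.1 o T)).2 p
  rw [← ENNReal.ofReal_toReal (measure_ne_top (percLaw G p) _)]
  exact ENNReal.ofReal_le_ofReal (h1.trans_le (h W.1 W.2.1 W.2.2))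

/-- Below the threshold, connection probabilities below height `1` decay exponentially, uniformly
over all positions of the graph. -/
lemma exists_prob_joinedIn_le_pow (hG : IsGeodesicTransitiveGraph G) (ho : origin n ∈ V)
    {p : unitInterval} (hp : (p : ℝ) < pZero G ho) {M : ℝ} (hM0 : 0 ≤ M)
    (hM : ∀ u v : V, G.Adj u v → hdist (u : HalfSpace n) v ≤ M) :
    ∃ c : ℝ, 0 < c ∧ ∀ (m : ℕ) (r : ℝ), m * c ≤ r →
      ∀ Φ : Equiv.Perm (HalfSpace n), IsHIsometry Φ → ∀ v : V, ∀ W : Finset V,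
      (W : Set V) ⊆ lowVertices V Φ → v ∈ W →
      prob p (edgesIn G W) (JoinedIn W v {u | r ≤ projDist (Φ v) (Φ u)}) ≤ (1 / 2) ^ m := by
  -- If the null set were empty, its supremum would be `0` by convention, which is not above `p`.
  have hne : ((fun p : unitInterval => (p : ℝ)) '' nullSet G ho).Nonempty := by
    by_contra h
    rw [Set.not_nonempty_iff_eq_empty] at h
    rw [pZero, h, Real.sSup_empty] at hp
    exact absurd p.2.1 (not_le.2 hp)
  obtain ⟨_, ⟨q, hq, rfl⟩, hpq⟩ := exists_lt_of_lt_csSup hne hp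
  simp only at hpq
  -- This is the lower bound that `prob_joinedIn_ge` yields at `q` for `c = 1 / 2`.
  have hε : 0 < 1 - Real.exp (-(1 / 2 * ((q : ℝ) - p))) :=
    sub_pos.2 (Real.exp_lt_one_iff.2 (by linarith))
  obtain ⟨k, hk⟩ := exists_uniform_small hG ho hq hε
  have hK : 0 ≤ 2 * Real.sinh (M / 2) :=
    mul_nonneg zero_le_two (Real.sinh_nonneg_iff.2 (by linarith))
  refine ⟨((k : ℝ) + 1) + 2 * Real.sinh (M / 2), by positivity, ?_⟩
  intro m r hr Φ hΦ v W hW hv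
  refine prob_joinedIn_le_pow (L := lowVertices V Φ)
    (D := fun x y => projDist (Φ x) (Φ y)) p.2.1 p.2.2
    (fun x y z => projDist_triangle _ _ _) hK ?_ ?_ (by positivity) m r hr v W hW hv
  · intro x hx y hy hxy
    refine (projDist_le _ _).trans (norm_sub_le_of_hdist_le ?_ hx hy)
    rw [hΦ]
    exact hM x y hxy
  · intro v _ W hW hv
    by_contra hcon
    push Not at hcon
    -- Any `S ⊆ W` that misses `T` has projection radius below `k + 1`. If all such sets around `v`
    -- had sum above `1 / 2`, the connection probability at `q` would contradict the choice of `k`.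
    set T : Set V := {u | u ∈ W ∧ (k : ℝ) + 1 ≤ projDist (Φ v) (Φ u)}
    have h1 := prob_joinedIn_ge (T := T) p.2.1 hpq.le q.2.2 hv (fun u hu => hu.1) (c := 1 / 2)
      (fun S hSW hvS hd => (hcon S hSW hvS fun u hu => by
        by_contra hlt
        exact Set.disjoint_left.1 hd hu ⟨hSW hu, not_lt.1 hlt⟩).le)
    have h2 := hk Φ hΦ v W hv fun u hu => hW hu
    have h3 : prob q (edgesIn G W) (JoinedIn W v T) ≤ prob q (edgesIn G W)
        (JoinedIn W v {u | (k : ℝ) + 1 ≤ projDist (Φ v) (Φ u)}) :=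
      prob_mono q.2.1 q.2.2 _ fun ω => JoinedIn.mono subset_rfl (fun u hu => hu.2) subset_rfl
    linarith

/-- The probability of reaching positive distance is bounded away from `1`. -/
lemma exists_percLaw_joinsTo_le (hG : IsGeodesicTransitiveGraph G) (ho : origin n ∈ V)
    {p : unitInterval} (hp : (p : ℝ) < 1) :
    ∃ a : ℝ, a < 1 ∧ ∀ (r h : ℝ) (R : E n ≃ₗᵢ[ℝ] E n) (Φ : Equiv.Perm (HalfSpace n)),
      0 < r → IsPhi h R Φ →
      percLaw G p {ω | JoinsTo (clippedGraph ω Φ (lowerRegion n 1)) (Φ (origin n))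
        (sphereS n r)} ≤ ENNReal.ofReal a := by
  set F := (finite_incident_edges hG ⟨origin n, ho⟩).toFinset
  obtain ⟨hm, hprob⟩ := setBernoulli_inter_eq p F ∅ (Finset.empty_subset F)
  have hpos : 0 < (percLaw G p).real {ω | ω ∩ F = (∅ : Finset G.edgeSet)} := by
    refine lt_of_lt_of_eq ?_ hprob.symm
    refine Finset.prod_pos fun i _ => ?_
    rw [if_neg (Finset.notMem_empty i)]
    linarith
  -- The complementary event, that all of the finitely many edges at `o` are closed, has positive
  -- probability because `p < 1`.
  refine ⟨1 - (percLaw G p).real {ω | ω ∩ F = (∅ : Finset G.edgeSet)}, by linarith, ?_⟩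
  intro r h R Φ hr hΦ
  have hsub : {ω : Set G.edgeSet | JoinsTo (clippedGraph ω Φ (lowerRegion n 1)) (Φ (origin n))
      (sphereS n r)} ⊆ {ω | ω ∩ F = (∅ : Finset G.edgeSet)}ᶜ := by
    intro ω hj hω
    refine not_joinsTo_of_isolated hG ho hr hΦ (fun e he hoe => ?_) hj
    have : e ∈ ω ∩ (F : Set G.edgeSet) := ⟨he, by simpa [F] using hoe⟩
    have hω' : ω ∩ (F : Set G.edgeSet) = ((∅ : Finset G.edgeSet) : Set G.edgeSet) := hω
    rw [hω'] at this
    simp at this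
  refine (measure_mono hsub).trans ?_
  rw [← ENNReal.ofReal_toReal (measure_ne_top (percLaw G p) _), ← measureReal_def,
    probReal_compl_eq_one_sub hm]

lemma pZero_le_one (ho : origin n ∈ V) : pZero G ho ≤ 1 := by
  refine Real.sSup_le ?_ zero_le_one
  rintro _ ⟨q, _, rfl⟩
  exact q.2.2

/-- Exponential decay of `gFun` below the threshold. -/
theorem exists_gFun_le_exp (hG : IsGeodesicTransitiveGraph G) (ho : origin n ∈ V)
    {p : unitInterval} (hp : (p : ℝ) < pZero G ho) :
    ∃ ψ : ℝ, 0 < ψ ∧ ∀ r : ℝ, 0 < r →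
      gFun G p r ≤ ENNReal.ofReal (Real.exp (-ψ * r)) := by
  have hcount := countable_vertices hG
  obtain ⟨M, hM0, hM⟩ := exists_hdist_le hG ho
  obtain ⟨c, hc, hpow⟩ := exists_prob_joinedIn_le_pow hG ho hp hM0 hM
  obtain ⟨a, ha, hone⟩ := exists_percLaw_joinsTo_le hG ho (hp.trans_le (pZero_le_one ho))
  set K := 2 * Real.sinh (M / 2)
  have hK : 0 ≤ K := mul_nonneg zero_le_two (Real.sinh_nonneg_iff.2 (by linarith))
  have hlog : 0 < Real.log 2 := Real.log_pos one_lt_two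
  -- The first rate serves `r ≥ 2 (K + c)`, where `m ≥ r / (2 c)` factors `1 / 2` are available. The
  -- second gives `ψ r ≤ 1 - a` for smaller `r`, so that `a ≤ exp (a - 1) ≤ exp (-ψ r)`.
  refine ⟨min (Real.log 2 / (2 * c)) ((1 - a) / (2 * (K + c))),
    lt_min (by positivity) (div_pos (by linarith) (by positivity)), fun r hr => ?_⟩
  set ψ := min (Real.log 2 / (2 * c)) ((1 - a) / (2 * (K + c)))
  refine iSup_le fun h => iSup_le fun R => iSup_le fun Φ => iSup_le fun ⟨hh, hΦ⟩ => ?_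
  rcases le_or_gt (2 * (K + c)) r with hlarge | hsmall
  · set m := ⌊(r - K) / c⌋₊
    have hrK : 0 ≤ (r - K) / c := div_nonneg (by linarith) hc.le
    have hmc : m * c ≤ r - K := by
      have := Nat.floor_le hrK
      rwa [le_div_iff₀ hc] at this
    -- Rounding down loses at most `c`, and `r - K - c ≥ r / 2` in this range.
    have hm : r / (2 * c) ≤ m := by
      have h1 := Nat.lt_floor_add_one ((r - K) / c)
      rw [div_lt_iff₀ hc] at h1
      rw [div_le_iff₀ (by positivity)]
      have : (m : ℝ) = (⌊(r - K) / c⌋₊ : ℝ) := rfl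
      nlinarith
    have hle : percLaw G p {ω | JoinsTo (clippedGraph ω Φ (lowerRegion n 1)) (Φ (origin n))
        (sphereS n r)} ≤ ENNReal.ofReal ((1 / 2) ^ m) :=
      (measure_mono fun ω hj => exists_joinedIn_of_joinsTo hG ho hM0 hM hΦ hh.2 hj).trans
        (percLaw_joinedIn_le p ((height_of_isPhi hΦ).trans_le hh.2) fun W hW hoW =>
          hpow m _ hmc Φ hΦ.isometry _ W hW hoW)
    refine hle.trans (ENNReal.ofReal_le_ofReal ?_)
    have h2 : ((1 : ℝ) / 2) ^ m = Real.exp (-(m * Real.log 2)) := by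
      rw [Real.exp_neg, Real.exp_nat_mul, Real.exp_log two_pos, one_div, inv_pow]
    rw [h2, Real.exp_le_exp, neg_mul, neg_le_neg_iff]
    calc ψ * r ≤ Real.log 2 / (2 * c) * r := mul_le_mul_of_nonneg_right (min_le_left _ _) hr.le
      _ = r / (2 * c) * Real.log 2 := by ring
      _ ≤ m * Real.log 2 := mul_le_mul_of_nonneg_right hm hlog.le
  · refine (hone r h R Φ hr hΦ).trans (ENNReal.ofReal_le_ofReal ?_)
    have h1 : ψ * r ≤ 1 - a := by
      have hψ : ψ ≤ (1 - a) / (2 * (K + c)) := min_le_right _ _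
      rw [le_div_iff₀ (by positivity)] at hψ
      have hψ0 : 0 ≤ ψ := (lt_min (by positivity) (div_pos (by linarith) (by positivity))).le
      nlinarith
    have h2 := Real.add_one_le_exp (a - 1)
    have h3 : Real.exp (a - 1) ≤ Real.exp (-ψ * r) := Real.exp_le_exp.2 (by linarith)
    linarith

end HypPerc

theorem mainTheorem7 (n : ℕ) (hn : 1 ≤ n) (V : Set (HypPerc.HalfSpace n)) (G : SimpleGraph V)
    (hG : HypPerc.IsGeodesicTransitiveGraph G) (ho : HypPerc.origin n ∈ V)
    (p : unitInterval) (hp : (p : ℝ) < HypPerc.pZero G ho) :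
    ∃ ψ : ℝ, 0 < ψ ∧ ∀ r : ℝ, 0 < r →
      HypPerc.gFun G p r ≤ ENNReal.ofReal (Real.exp (-ψ * r)) := by
  exact HypPerc.exists_gFun_le_exp hG ho hp
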